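/- Let $k$ be a natural number, let $G$ be a finite simple 2-connected graph, and let $x_1, x_2, y, z$ be four distinct vertices of $G$ of degree $2$. Assume that every other vertex of $G$ has degree $3$, and that $\mathrm{dist}_G(x_i, y) \ge k$ for $i = 1, 2$. Then at least one of the following holds: (i) $G$ contains two $x_1$–$x_2$ paths $P_1, P_2$ with $|E(P_1)| - |E(P_2)| \in \{1, 2\}$; (ii) $G$ contains two (vertex-)disjoint $\{x_1,x_2\}$–$\{y,z\}$ paths $Q_1, Q_2$ such that at least $k$ edges of $G$ have one end on $Q_1$ and the other end on $Q_2$. Here, for sets $A, B$ of vertices, an $A$–$B$ path is a path with one end in $A$, the other end in $B$, and no internal vertex in $A \cup B$. A graph is 2-connected if it has at least three vertices, is connected, and remains connected after the deletion of any one vertex. -/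

import Mathlib

namespace SimpleGraph

/-- `G` is 2-connected: it has more than two vertices, it is connected, and it stays connected
whenever a single vertex is deleted. -/
structure IsTwoConnected {V : Type*} (G : SimpleGraph V) : Prop where
  two_lt_card : 2 < ENat.card V
  connected : G.Connected
  connected_delete : ∀ v : V, (G.induce ({v}ᶜ : Set V)).Connected

/-- The walk `p` is an `A`–`B` path: it is a path with its first vertex in `A`, its last vertex
in `B`, and none of its internal vertices in `A ∪ B`. -/
structure Walk.IsPathBetween {V : Type*} {G : SimpleGraph V} {u v : V} (p : G.Walk u v)
    (A B : Set V) : Prop where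
  isPath : p.IsPath
  start_mem : u ∈ A
  end_mem : v ∈ B
  internal : ∀ w ∈ p.support, w ≠ u → w ≠ v → w ∉ A ∪ B

/-- `E(A, B)`: the set of edges of `G` having an end in both `A` and `B`. -/
def edgesBetween {V : Type*} (G : SimpleGraph V) (A B : Set V) : Set (Sym2 V) :=
  {e | e ∈ G.edgeSet ∧ (∃ a ∈ A, a ∈ e) ∧ ∃ b ∈ B, b ∈ e}

end SimpleGraph

set_option linter.unusedSectionVars false

/-! The induction runs over regions: subcubic pieces with a half-edge at each of two ends, such that
at least two edges or half-edges leave every nonempty vertex set. With half-edges at `x₁` and `x₂`,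
the whole graph is a region whose only vertices of degree two are `y` and `z`.

A region with at most one vertex of degree two has two end-to-end paths with lengths differing by
one or two, unless it is a single vertex (`Region.closeLengths_or_singleton`). Ends of degree two
and adjacent ends can be deleted, and if no cycle through `x₁` avoids `x₂`, the region splits into
two smaller ones. Otherwise take a cycle through `x₁` and, off it, a connected set `D` containing
`x₂`, with `D` as large as possible (`Necklace`). By maximality every neighbour of `D` lies on all
cycles through `x₁` outside `D`, so these attachments cut the rest into gaps, each a smaller region.
An attachment almost opposite `x₁` yields two paths, one along each arc. A gap with close path
lengths passes them on. Otherwise both almost opposite vertices have degree two, one too many.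

With two vertices `y`, `z` of degree two (`Region.closeLengths_or_ladder`), this argument applied
from both ends either gives close lengths or traps `y` and `z` in one gap `R` not next to `x₁`. Then
`R` and its complement are both smaller regions, the complement having the two attachments around
`R` as its vertices of degree two, and their ladders are glued. Having `k + 1` rungs for distance
`k` is the invariant that survives: the glueing edges cost one unit of distance, and the extra rung
of one part pays for it. -/

namespace SimpleGraph

/-! ### Paths, walks and components inside a vertex set -/

section Paths

variable {V : Type*} [DecidableEq V] {G : SimpleGraph V}

/-- `A` is the vertex set of a path of length `n` from `u` to `v`. -/
def PathOn (G : SimpleGraph V) (A : Finset V) (u v : V) (n : ℕ) : Prop :=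
  ∃ p : G.Walk u v, p.IsPath ∧ p.length = n ∧ p.support.toFinset = A

/-- There is a path of length `n` from `u` to `v` inside `S`. -/
def HasPath (G : SimpleGraph V) (S : Finset V) (u v : V) (n : ℕ) : Prop :=
  ∃ A ⊆ S, G.PathOn A u v n

/-- There is a walk from `u` to `v` inside `S`. -/
def Reach (G : SimpleGraph V) (S : Finset V) (u v : V) : Prop :=
  ∃ p : G.Walk u v, ∀ w ∈ p.support, w ∈ S

/-- There are two paths from `u` to `v` inside `S` whose lengths differ by one or two. -/
def CloseLengths (G : SimpleGraph V) (S : Finset V) (u v : V) : Prop :=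
  ∃ n n', G.HasPath S u v n ∧ G.HasPath S u v n' ∧ (n' = n + 1 ∨ n' = n + 2)

theorem PathOn.single (u : V) : G.PathOn {u} u u 0 :=
  ⟨.nil, .nil, rfl, by simp⟩

theorem PathOn.append {A B : Finset V} {u v w x : V} {n k : ℕ} (h₁ : G.PathOn A u v n)
    (h₂ : G.PathOn B w x k) (hvw : G.Adj v w) (hd : Disjoint A B) :
    G.PathOn (A ∪ B) u x (n + k + 1) := by
  obtain ⟨p, hp, rfl, rfl⟩ := h₁
  obtain ⟨q, hq, rfl, rfl⟩ := h₂
  refine ⟨p.append (.cons hvw q), ?_, by simp [Walk.length_append]; omega, ?_⟩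
  · rw [Walk.isPath_def, Walk.support_append, Walk.support_cons, List.tail_cons,
      List.nodup_append']
    refine ⟨hp.support_nodup, hq.support_nodup, ?_⟩
    intro a ha hb
    exact Finset.disjoint_left.1 hd (List.mem_toFinset.2 ha) (List.mem_toFinset.2 hb)
  · rw [Walk.support_append, Walk.support_cons, List.tail_cons, List.toFinset_append]

theorem PathOn.reverse {A : Finset V} {u v : V} {n : ℕ} (h : G.PathOn A u v n) :
    G.PathOn A v u n := by
  obtain ⟨p, hp, rfl, rfl⟩ := h
  exact ⟨p.reverse, hp.reverse, by simp, by ext; simp⟩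

theorem HasPath.single {S : Finset V} {u : V} (hu : u ∈ S) : G.HasPath S u u 0 :=
  ⟨{u}, by simpa using hu, .single u⟩

theorem HasPath.mono {S T : Finset V} {u v : V} {n : ℕ} (h : G.HasPath S u v n) (hST : S ⊆ T) :
    G.HasPath T u v n := by
  obtain ⟨A, hA, h⟩ := h
  exact ⟨A, hA.trans hST, h⟩

theorem HasPath.reverse {S : Finset V} {u v : V} {n : ℕ} (h : G.HasPath S u v n) :
    G.HasPath S v u n := by
  obtain ⟨A, hA, h⟩ := h
  exact ⟨A, hA, h.reverse⟩

theorem HasPath.append {S T X : Finset V} {u v w x : V} {n k : ℕ} (h₁ : G.HasPath S u v n)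
    (h₂ : G.HasPath T w x k) (hvw : G.Adj v w) (hd : Disjoint S T) (hS : S ⊆ X) (hT : T ⊆ X) :
    G.HasPath X u x (n + k + 1) := by
  obtain ⟨A, hA, h₁⟩ := h₁
  obtain ⟨B, hB, h₂⟩ := h₂
  exact ⟨A ∪ B, Finset.union_subset (hA.trans hS) (hB.trans hT),
    h₁.append h₂ hvw (hd.mono hA hB)⟩

theorem CloseLengths.mono {S T : Finset V} {u v : V} (h : G.CloseLengths S u v) (hST : S ⊆ T) :
    G.CloseLengths T u v := by
  obtain ⟨n, n', h₁, h₂, h⟩ := h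
  exact ⟨n, n', h₁.mono hST, h₂.mono hST, h⟩

theorem CloseLengths.reverse {S : Finset V} {u v : V} (h : G.CloseLengths S u v) :
    G.CloseLengths S v u := by
  obtain ⟨n, n', h₁, h₂, h⟩ := h
  exact ⟨n, n', h₁.reverse, h₂.reverse, h⟩

theorem CloseLengths.append {S T X : Finset V} {u v w x : V} {n : ℕ} (h₁ : G.CloseLengths S u v)
    (h₂ : G.HasPath T w x n) (hvw : G.Adj v w) (hd : Disjoint S T) (hS : S ⊆ X) (hT : T ⊆ X) :
    G.CloseLengths X u x := by
  obtain ⟨k, k', hk, hk', h⟩ := h₁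
  exact ⟨_, _, hk.append h₂ hvw hd hS hT, hk'.append h₂ hvw hd hS hT, by omega⟩

theorem CloseLengths.sandwich {P R Q X : Finset V} {x p r r' q y : V} {n k : ℕ}
    (h : G.CloseLengths R r r') (hP : G.HasPath P x p n) (hQ : G.HasPath Q q y k)
    (hpr : G.Adj p r) (hrq : G.Adj r' q) (hPR : Disjoint P R) (hRQ : Disjoint R Q)
    (hPQ : Disjoint P Q) (hPX : P ⊆ X) (hRX : R ⊆ X) (hQX : Q ⊆ X) : G.CloseLengths X x y :=
  ((h.append hQ hrq hRQ Finset.subset_union_left Finset.subset_union_right).reverse.append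
    hP.reverse hpr.symm (Finset.disjoint_union_left.2 ⟨hPR.symm, hPQ.symm⟩)
    (Finset.union_subset hRX hQX) hPX).reverse

theorem Reach.refl {S : Finset V} {u : V} (hu : u ∈ S) : G.Reach S u u :=
  ⟨.nil, by simpa using hu⟩

theorem Reach.symm {S : Finset V} {u v : V} (h : G.Reach S u v) : G.Reach S v u := by
  obtain ⟨p, hp⟩ := h
  exact ⟨p.reverse, by simpa using hp⟩

theorem Reach.trans {S : Finset V} {u v w : V} (h₁ : G.Reach S u v) (h₂ : G.Reach S v w) :
    G.Reach S u w := by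
  obtain ⟨p, hp⟩ := h₁
  obtain ⟨q, hq⟩ := h₂
  refine ⟨p.append q, fun x hx ↦ ?_⟩
  rw [Walk.mem_support_append_iff] at hx
  exact hx.elim (hp x) (hq x)

theorem Reach.mono {S T : Finset V} {u v : V} (h : G.Reach S u v) (hST : S ⊆ T) :
    G.Reach T u v := by
  obtain ⟨p, hp⟩ := h
  exact ⟨p, fun w hw ↦ hST (hp w hw)⟩

theorem Reach.of_adj {S : Finset V} {u v : V} (h : G.Adj u v) (hu : u ∈ S) (hv : v ∈ S) :
    G.Reach S u v :=
  ⟨h.toWalk, by simp [hu, hv]⟩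

theorem Reach.left_mem {S : Finset V} {u v : V} (h : G.Reach S u v) : u ∈ S := by
  obtain ⟨p, hp⟩ := h
  exact hp _ p.start_mem_support

theorem Reach.right_mem {S : Finset V} {u v : V} (h : G.Reach S u v) : v ∈ S :=
  h.symm.left_mem

theorem Reach.exists_hasPath {S : Finset V} {u v : V} (h : G.Reach S u v) :
    ∃ n, G.HasPath S u v n := by
  obtain ⟨p, hp⟩ := h
  refine ⟨_, _, ?_, p.toPath.1, p.toPath.2, rfl, rfl⟩
  intro w hw
  exact hp w (p.support_toPath_subset_support (List.mem_toFinset.1 hw))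

/-- A property of vertices of `S` that passes to neighbours in `S` passes along walks in `S`. -/
theorem Reach.induction {S : Finset V} {u v : V} (h : G.Reach S u v) {P : V → Prop} (hu : P u)
    (hstep : ∀ x ∈ S, ∀ y ∈ S, P x → G.Adj x y → P y) : P v := by
  obtain ⟨p, hp⟩ := h
  induction p with
  | nil => exact hu
  | cons hadj p ih =>
    refine ih ?_ fun w hw ↦ hp w (by simp [hw])
    exact hstep _ (hp _ (by simp)) _ (hp _ (by simp)) hu hadj

/-- A walk inside `S` that starts in `W` and ends outside `W` uses an edge leaving `W`. -/
theorem Reach.exists_adj {S : Finset V} {u v : V} (h : G.Reach S u v) {W : Finset V}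
    (hu : u ∈ W) (hv : v ∉ W) : ∃ x ∈ S, ∃ y ∈ S, x ∈ W ∧ y ∉ W ∧ G.Adj x y := by
  by_contra! hcon
  exact hv (h.induction (P := (· ∈ W)) hu fun x hx y hy hxW hxy ↦
    by_contra fun hyW ↦ hcon x hx y hy hxW hyW hxy)

open Classical in
/-- The vertices that can be reached from `v` inside `S`. -/
noncomputable def comp (G : SimpleGraph V) (S : Finset V) (v : V) : Finset V :=
  S.filter (G.Reach S v)

theorem mem_comp {S : Finset V} {v w : V} : w ∈ G.comp S v ↔ G.Reach S v w := by
  classical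
  rw [comp, Finset.mem_filter]
  exact ⟨fun h ↦ h.2, fun h ↦ ⟨h.right_mem, h⟩⟩

theorem comp_subset {S : Finset V} {v : V} : G.comp S v ⊆ S := by
  classical
  exact Finset.filter_subset _ _

theorem mem_comp_of_adj {S : Finset V} {v w x : V} (hw : w ∈ G.comp S v) (hx : x ∈ S)
    (h : G.Adj w x) : x ∈ G.comp S v := by
  rw [mem_comp] at *
  exact hw.trans (.of_adj h hw.right_mem hx)

theorem Reach.in_comp {S : Finset V} {v w : V} (h : G.Reach S v w) :
    G.Reach (G.comp S v) v w := by
  have hv : v ∈ G.comp S v := mem_comp.2 (.refl h.left_mem)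
  refine h.induction (P := fun w ↦ G.Reach (G.comp S v) v w) (.refl hv) ?_
  intro x hx y hy hvx hxy
  exact hvx.trans (.of_adj hxy hvx.right_mem (mem_comp_of_adj hvx.right_mem hy hxy))

theorem reach_comp_of_mem {S : Finset V} {v w x : V} (hw : w ∈ G.comp S v)
    (hx : x ∈ G.comp S v) : G.Reach (G.comp S v) w x :=
  ((mem_comp.1 hw).in_comp.symm).trans (mem_comp.1 hx).in_comp

/-- Consecutively adjacent, pairwise distinct vertices form a path. -/
theorem PathOn.of_seq {c : ℕ → V} {s t : ℕ} (hst : s ≤ t)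
    (hadj : ∀ k, s ≤ k → k < t → G.Adj (c k) (c (k + 1)))
    (hinj : Set.InjOn c (Set.Icc s t)) :
    G.PathOn ((Finset.Icc s t).image c) (c s) (c t) (t - s) := by
  induction t, hst using Nat.le_induction with
  | base => simpa using PathOn.single (G := G) (c s)
  | succ t hst ih =>
    have h := (ih (fun k h1 h2 ↦ hadj k h1 (by omega))
      (hinj.mono (Set.Icc_subset_Icc_right (by omega)))).append
      (.single (c (t + 1))) (hadj t hst (by omega)) (by
        rw [Finset.disjoint_singleton_right, Finset.mem_image]
        rintro ⟨k, hk, hkt⟩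
        rw [Finset.mem_Icc] at hk
        have := hinj (by simp; omega) (by simp; omega) hkt
        omega)
    rw [← Finset.insert_Icc_right_eq_Icc_add_one (by omega), Finset.image_insert,
      Finset.insert_eq, Finset.union_comm]
    convert h using 1
    omega

theorem Reach.of_seq {c : ℕ → V} {S : Finset V} {s t : ℕ} (hst : s ≤ t)
    (hadj : ∀ k, s ≤ k → k < t → G.Adj (c k) (c (k + 1)))
    (hS : ∀ k, s ≤ k → k ≤ t → c k ∈ S) : G.Reach S (c s) (c t) := by
  induction t, hst using Nat.le_induction with
  | base => exact .refl (hS s le_rfl le_rfl)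
  | succ t hst ih =>
    exact (ih (fun k h1 h2 ↦ hadj k h1 (by omega)) fun k h1 h2 ↦ hS k h1 (by omega)).trans
      (.of_adj (hadj t hst (by omega)) (hS t hst (by omega)) (hS _ (by omega) le_rfl))

end Paths

/-! ### Regions and their reductions -/

section Regions

variable {V : Type*} [DecidableEq V] {G : SimpleGraph V} [DecidableRel G.Adj]

/-- The neighbours of `v` that lie in `S`. -/
def nb (G : SimpleGraph V) [DecidableRel G.Adj] (S : Finset V) (v : V) : Finset V :=
  S.filter (G.Adj v)

@[simp] theorem mem_nb {S : Finset V} {v w : V} : w ∈ G.nb S v ↔ w ∈ S ∧ G.Adj v w :=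
  Finset.mem_filter

/-- The number of times that `v` occurs among `x₁`, `x₂`. -/
def port (x₁ x₂ v : V) : ℕ := (if v = x₁ then 1 else 0) + (if v = x₂ then 1 else 0)

theorem port_comm (x₁ x₂ v : V) : port x₁ x₂ v = port x₂ x₁ v := Nat.add_comm _ _

/-- The degree of `v` in `S`, where `x₁` and `x₂` carry an additional half-edge each. -/
def wdeg (G : SimpleGraph V) [DecidableRel G.Adj] (S : Finset V) (x₁ x₂ v : V) : ℕ :=
  (G.nb S v).card + port x₁ x₂ v

/-- `G[S]`, with an additional half-edge at each of `x₁` and `x₂`, is subcubic and at least two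
edges or half-edges leave each nonempty subset of `S`. -/
structure Region (G : SimpleGraph V) [DecidableRel G.Adj] (S : Finset V) (x₁ x₂ : V) : Prop where
  left_mem : x₁ ∈ S
  right_mem : x₂ ∈ S
  wdeg_le : ∀ v ∈ S, G.wdeg S x₁ x₂ v ≤ 3
  two_le_cut : ∀ W ⊆ S, W.Nonempty → 2 ≤ ∑ v ∈ W, ((G.nb (S \ W) v).card + port x₁ x₂ v)

variable {S R : Finset V} {x₁ x₂ r r' : V}

theorem wdeg_comm (v : V) : G.wdeg S x₁ x₂ v = G.wdeg S x₂ x₁ v := by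
  rw [wdeg, port_comm, wdeg]

theorem Region.symm (h : G.Region S x₁ x₂) : G.Region S x₂ x₁ where
  left_mem := h.right_mem
  right_mem := h.left_mem
  wdeg_le v hv := wdeg_comm (G := G) (S := S) v ▸ h.wdeg_le v hv
  two_le_cut W hW hne := by simpa only [port_comm x₂ x₁] using h.two_le_cut W hW hne

theorem card_nb_add {T : Finset V} (hRT : Disjoint R T) (v : V) :
    (G.nb (R ∪ T) v).card = (G.nb R v).card + (G.nb T v).card := by
  rw [nb, Finset.filter_union, Finset.card_union_of_disjoint]
  · rfl
  · exact Finset.disjoint_filter_filter hRT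

theorem wdeg_sub (hRS : R ⊆ S) {v : V}
    (h : (G.nb (S \ R) v).card + port x₁ x₂ v = port r r' v) :
    G.wdeg R r r' v = G.wdeg S x₁ x₂ v := by
  have := card_nb_add (G := G) (Finset.disjoint_sdiff (s := R) (t := S)) v
  rw [Finset.union_sdiff_of_subset hRS] at this
  rw [wdeg, wdeg, this, ← h]
  omega

/-- The new half-edges stand exactly for the edges and half-edges by which `R` is left in `S`, so
degrees and cuts inside `R` keep their values. -/
theorem Region.sub (hS : G.Region S x₁ x₂) (hRS : R ⊆ S) (hr : r ∈ R) (hr' : r' ∈ R)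
    (h : ∀ v ∈ R, (G.nb (S \ R) v).card + port x₁ x₂ v = port r r' v) :
    G.Region R r r' where
  left_mem := hr
  right_mem := hr'
  wdeg_le v hv := wdeg_sub hRS (h v hv) ▸ hS.wdeg_le v (hRS hv)
  two_le_cut W hW hne := by
    refine (hS.two_le_cut W (hW.trans hRS) hne).trans_eq (Finset.sum_congr rfl fun v hv ↦ ?_)
    have : S \ W = (R \ W) ∪ (S \ R) := by
      ext w
      have := @hRS w
      have := @hW w
      simp only [Finset.mem_union, Finset.mem_sdiff]
      tauto
    rw [this, card_nb_add (Finset.disjoint_sdiff.mono_left Finset.sdiff_subset), ← h v (hW hv)]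
    omega

/-- Supplies the hypothesis of `Region.sub` when just two edges leave `R`. Distinct outer ends `p`,
`q` ensure that they count twice even if `r = r'`. -/
theorem exits_card {p q : V} (hp : p ∈ S \ R) (hq : q ∈ S \ R) (hpq : p ≠ q)
    (hx₁ : x₁ ∉ R) (hx₂ : x₂ ∉ R)
    (h : ∀ v ∈ R, ∀ w ∈ S \ R, G.Adj v w ↔ v = r ∧ w = p ∨ v = r' ∧ w = q) :
    ∀ v ∈ R, (G.nb (S \ R) v).card + port x₁ x₂ v = port r r' v := by
  intro v hv
  have h1 : v ≠ x₁ := fun h ↦ hx₁ (h ▸ hv)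
  have h2 : v ≠ x₂ := fun h ↦ hx₂ (h ▸ hv)
  have : G.nb (S \ R) v = (if v = r then {p} else ∅) ∪ (if v = r' then {q} else ∅) := by
    ext w
    rw [mem_nb]
    constructor
    · rintro ⟨hw, hadj⟩
      rcases (h v hv w hw).1 hadj with ⟨rfl, rfl⟩ | ⟨rfl, rfl⟩ <;> simp
    · intro hw
      rw [Finset.mem_union] at hw
      rcases hw with hw | hw
      · split_ifs at hw with hvr
        · rw [Finset.mem_singleton] at hw
          subst hw
          exact ⟨hp, (h v hv w hp).2 (.inl ⟨hvr, rfl⟩)⟩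
        · simp at hw
      · split_ifs at hw with hvr
        · rw [Finset.mem_singleton] at hw
          subst hw
          exact ⟨hq, (h v hv w hq).2 (.inr ⟨hvr, rfl⟩)⟩
        · simp at hw
  rw [this, port, port, if_neg h1, if_neg h2, Finset.card_union_of_disjoint]
  · split_ifs <;> simp
  · split_ifs <;> simp [hpq]

/-- Without half-edges at `W`, two genuine edges leave it, so one remains when the edge `v₀w₀` is
ruled out. -/
theorem Region.exists_exit (hS : G.Region S x₁ x₂) {W : Finset V} (hW : W ⊆ S) (hne : W.Nonempty)
    (hx₁ : x₁ ∉ W) (hx₂ : x₂ ∉ W) (v₀ w₀ : V) :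
    ∃ v ∈ W, ∃ w ∈ S, w ∉ W ∧ G.Adj v w ∧ ¬ (v = v₀ ∧ w = w₀) := by
  by_contra! hcon
  have h := hS.two_le_cut W hW hne
  have hle : ∑ v ∈ W, ((G.nb (S \ W) v).card + port x₁ x₂ v) ≤
      ∑ v ∈ W, if v = v₀ then 1 else 0 := by
    refine Finset.sum_le_sum fun v hv ↦ ?_
    have h1 : v ≠ x₁ := fun h ↦ hx₁ (h ▸ hv)
    have h2 : v ≠ x₂ := fun h ↦ hx₂ (h ▸ hv)
    rw [port, if_neg h1, if_neg h2]
    have hsub : G.nb (S \ W) v ⊆ if v = v₀ then {w₀} else ∅ := by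
      intro w hw
      rw [mem_nb, Finset.mem_sdiff] at hw
      have := hcon v hv w hw.1.1 hw.1.2 hw.2
      simp [this.1, this.2]
    refine (Finset.card_le_card hsub).trans ?_
    split_ifs <;> simp
  rw [Finset.sum_ite_eq'] at hle
  split_ifs at hle <;> omega

theorem Region.exists_exit_of_right_mem (hS : G.Region S x₁ x₂) {W : Finset V} (hW : W ⊆ S)
    (hx₁ : x₁ ∉ W) (hx₂ : x₂ ∈ W) : ∃ v ∈ W, ∃ w ∈ S, w ∉ W ∧ G.Adj v w := by
  by_contra! hcon
  have h := hS.two_le_cut W hW ⟨_, hx₂⟩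
  have hle : ∑ v ∈ W, ((G.nb (S \ W) v).card + port x₁ x₂ v) ≤
      ∑ v ∈ W, if v = x₂ then 1 else 0 := by
    refine Finset.sum_le_sum fun v hv ↦ ?_
    have h1 : v ≠ x₁ := fun h ↦ hx₁ (h ▸ hv)
    have : G.nb (S \ W) v = ∅ := by
      rw [Finset.eq_empty_iff_forall_notMem]
      intro w hw
      rw [mem_nb, Finset.mem_sdiff] at hw
      exact hcon v hv w hw.1.1 hw.1.2 hw.2
    simp [this, port, h1]
  rw [Finset.sum_ite_eq'] at hle
  split_ifs at hle
  omega

/-- Two different vertices of `W` with an edge or half-edge leaving `W` suffice for the cut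
condition, and so does a single one with two such edges. -/
theorem two_le_cut_of {W : Finset V} {v w : V} (hv : v ∈ W) (hw : w ∈ W)
    (h₁ : 1 ≤ (G.nb (S \ W) v).card + port x₁ x₂ v)
    (h₂ : 1 ≤ (G.nb (S \ W) w).card + port x₁ x₂ w)
    (h₃ : v = w → 2 ≤ (G.nb (S \ W) v).card + port x₁ x₂ v) :
    2 ≤ ∑ v ∈ W, ((G.nb (S \ W) v).card + port x₁ x₂ v) := by
  by_cases hvw : v = w
  · exact (h₃ hvw).trans (Finset.single_le_sum (f := fun v ↦ (G.nb (S \ W) v).card + port x₁ x₂ v)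
      (fun _ _ ↦ Nat.zero_le _) hv)
  · refine le_trans ?_ (Finset.sum_le_sum_of_subset (s := {v, w}) ?_)
    · rw [Finset.sum_pair hvw]
      omega
    · simp [Finset.insert_subset_iff, hv, hw]

/-- Two half-edges at `x₁` leave room for one edge only, which would be the sole exit from the
remaining vertices. -/
theorem Region.eq_singleton (hS : G.Region S x₁ x₁) : S = {x₁} := by
  by_contra hne
  have hW : (S \ {x₁}).Nonempty := by
    rw [Finset.sdiff_nonempty]
    intro h
    exact hne (Finset.Subset.antisymm h (Finset.singleton_subset_iff.2 hS.left_mem))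
  have h3 := hS.wdeg_le x₁ hS.left_mem
  simp only [wdeg, port, if_true] at h3
  have hcard : (G.nb S x₁).card ≤ 1 := by omega
  obtain ⟨v, hv, w, hw, hwW, hadj, -⟩ := hS.exists_exit Finset.sdiff_subset hW (by simp) (by simp) x₁ x₁
  have hwx : w = x₁ := by simpa [hw] using hwW
  subst hwx
  obtain ⟨v', hv', w', hw', hwW', hadj', hne'⟩ :=
    hS.exists_exit Finset.sdiff_subset hW (by simp) (by simp) v w
  have hwx' : w' = w := by simpa [hw'] using hwW'
  subst hwx'
  refine hne' ⟨Finset.card_le_one.1 hcard _ ?_ _ ?_, rfl⟩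
  · exact mem_nb.2 ⟨(Finset.mem_sdiff.1 hv').1, hadj'.symm⟩
  · exact mem_nb.2 ⟨(Finset.mem_sdiff.1 hv).1, hadj.symm⟩

theorem Region.two_le_wdeg (hS : G.Region S x₁ x₂) {v : V} (hv : v ∈ S) :
    2 ≤ G.wdeg S x₁ x₂ v := by
  have := hS.two_le_cut {v} (by simpa using hv) (by simp)
  rw [Finset.sum_singleton] at this
  refine this.trans (Nat.add_le_add_right (Finset.card_le_card ?_) _)
  intro w
  simp only [mem_nb, Finset.mem_sdiff]
  tauto

theorem Region.wdeg_eq_three (hS : G.Region S x₁ x₂) {v : V} (hv : v ∈ S)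
    (h : G.wdeg S x₁ x₂ v ≠ 2) : G.wdeg S x₁ x₂ v = 3 := by
  have := hS.two_le_wdeg hv
  have := hS.wdeg_le v hv
  omega

/-- Deleting an end of degree one. -/
theorem Region.delete_left (hS : G.Region S x₁ x₂) (hne : x₁ ≠ x₂)
    (h : G.wdeg S x₁ x₂ x₁ = 2) :
    ∃ a ∈ S \ {x₁}, G.Adj x₁ a ∧ G.Region (S \ {x₁}) a x₂ ∧
      ∀ v ∈ S \ {x₁}, G.wdeg (S \ {x₁}) a x₂ v = G.wdeg S x₁ x₂ v := by
  have hcard : (G.nb S x₁).card = 1 := by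
    simp only [wdeg, port, if_true, if_neg hne] at h
    omega
  obtain ⟨a, ha⟩ := Finset.card_eq_one.1 hcard
  have hmem : ∀ w, w ∈ S ∧ G.Adj x₁ w ↔ w = a := fun w ↦ by
    rw [← mem_nb, ha, Finset.mem_singleton]
  have haS := (hmem a).2 rfl
  have ha' : a ∈ S \ {x₁} := by simp [haS.1, haS.2.ne']
  have hex : ∀ v ∈ S \ {x₁}, (G.nb (S \ (S \ {x₁})) v).card + port x₁ x₂ v = port a x₂ v := by
    intro v hv
    rw [Finset.mem_sdiff, Finset.mem_singleton] at hv
    rw [Finset.sdiff_sdiff_eq_self (by simpa using hS.left_mem), port, if_neg hv.2, port]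
    have : (G.nb {x₁} v) = if v = a then {x₁} else ∅ := by
      ext w
      rw [mem_nb, Finset.mem_singleton]
      by_cases hva : v = a
      · subst hva
        simp only [if_true, Finset.mem_singleton]
        exact ⟨fun h ↦ h.1, fun h ↦ ⟨h, h ▸ haS.2.symm⟩⟩
      · simp only [if_neg hva, Finset.notMem_empty, iff_false]
        rintro ⟨rfl, hadj⟩
        exact hva ((hmem v).1 ⟨hv.1, hadj.symm⟩)
    rw [this]
    split_ifs <;> simp
  exact ⟨a, ha', haS.2, hS.sub Finset.sdiff_subset ha' (by simp [hS.right_mem, hne.symm]) hex,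
    fun v hv ↦ wdeg_sub Finset.sdiff_subset (hex v hv)⟩

theorem Region.exists_nb_eq_pair (hS : G.Region S x₁ x₂) (hne : x₁ ≠ x₂)
    (h : G.wdeg S x₁ x₂ x₁ ≠ 2) : ∃ a b, a ≠ b ∧ G.nb S x₁ = {a, b} := by
  have h3 := hS.wdeg_eq_three hS.left_mem h
  rw [← Finset.card_eq_two]
  simp only [wdeg, port, if_true, if_neg hne] at h3
  omega

theorem Region.exists_nb_eq_pair_of_adj (hS : G.Region S x₁ x₂) (hadj : G.Adj x₁ x₂)
    (h : G.wdeg S x₁ x₂ x₁ ≠ 2) : ∃ a, a ≠ x₂ ∧ G.nb S x₁ = {x₂, a} := by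
  obtain ⟨a, b, hab, hnb⟩ := hS.exists_nb_eq_pair hadj.ne h
  have : x₂ ∈ G.nb S x₁ := mem_nb.2 ⟨hS.right_mem, hadj⟩
  rw [hnb, Finset.mem_insert, Finset.mem_singleton] at this
  rcases this with rfl | rfl
  · exact ⟨b, hab.symm, hnb⟩
  · exact ⟨a, hab, by rw [hnb, Finset.pair_comm]⟩

/-- Deleting two adjacent ends. -/
theorem Region.delete_both (hS : G.Region S x₁ x₂) (hadj : G.Adj x₁ x₂)
    (h₁ : G.wdeg S x₁ x₂ x₁ ≠ 2) (h₂ : G.wdeg S x₁ x₂ x₂ ≠ 2) :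
    ∃ a ∈ S \ {x₁, x₂}, ∃ b ∈ S \ {x₁, x₂}, G.Adj x₁ a ∧ G.Adj x₂ b ∧
      G.Region (S \ {x₁, x₂}) a b ∧
      ∀ v ∈ S \ {x₁, x₂}, G.wdeg (S \ {x₁, x₂}) a b v = G.wdeg S x₁ x₂ v := by
  obtain ⟨a, hax, ha⟩ := hS.exists_nb_eq_pair_of_adj hadj h₁
  rw [wdeg_comm] at h₂
  obtain ⟨b, hbx, hb⟩ := hS.symm.exists_nb_eq_pair_of_adj hadj.symm h₂
  have hA : ∀ w, w ∈ S ∧ G.Adj x₁ w ↔ w = x₂ ∨ w = a := fun w ↦ by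
    rw [← mem_nb, ha, Finset.mem_insert, Finset.mem_singleton]
  have hB : ∀ w, w ∈ S ∧ G.Adj x₂ w ↔ w = x₁ ∨ w = b := fun w ↦ by
    rw [← mem_nb, hb, Finset.mem_insert, Finset.mem_singleton]
  have haS := (hA a).2 (.inr rfl)
  have hbS := (hB b).2 (.inr rfl)
  have ha' : a ∈ S \ {x₁, x₂} := by simp [haS.1, haS.2.ne', hax]
  have hb' : b ∈ S \ {x₁, x₂} := by simp [hbS.1, hbS.2.ne', hbx]
  have hsub : ({x₁, x₂} : Finset V) ⊆ S := by
    simp [Finset.insert_subset_iff, hS.left_mem, hS.right_mem]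
  have hex := exits_card (G := G) (S := S) (R := S \ {x₁, x₂}) (x₁ := x₁) (x₂ := x₂)
    (r := a) (r' := b) (p := x₁) (q := x₂)
    (by simp [hS.left_mem]) (by simp [hS.right_mem]) hadj.ne (by simp)
    (by simp) (by
      intro v hv w hw
      rw [Finset.sdiff_sdiff_eq_self hsub, Finset.mem_insert, Finset.mem_singleton] at hw
      simp only [Finset.mem_sdiff, Finset.mem_insert, Finset.mem_singleton, not_or] at hv
      rcases hw with rfl | rfl
      · have := hA v
        simp only [hv.1, true_and, hv.2.2, false_or] at this
        rw [G.adj_comm, this]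
        simp [hadj.ne]
      · have := hB v
        simp only [hv.1, true_and, hv.2.1, false_or] at this
        rw [G.adj_comm, this]
        simp [hadj.ne'])
  exact ⟨a, ha', b, hb', haS.2, hbS.2, hS.sub Finset.sdiff_subset ha' hb' hex,
    fun v hv ↦ wdeg_sub Finset.sdiff_subset (hex v hv)⟩

end Regions

/-! ### Splitting at both ends, and the existence of necklaces -/

section Necklaces

variable {V : Type*} [DecidableEq V] {G : SimpleGraph V} [DecidableRel G.Adj]
variable {S R D : Finset V} {x₁ x₂ : V} {m : ℕ} {c : ℕ → V}

/-- The component of `a` has an exit other than the edge `ax₁`. It cannot be `bx₁`, since `b` lies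
elsewhere, so it ends at `x₂`. -/
theorem Region.exists_adj_right_of_comp (hS : G.Region S x₁ x₂) {a b : V}
    (hnb : G.nb S x₁ = {a, b}) (hax : a ≠ x₂) (hr : ¬ G.Reach (S \ {x₁, x₂}) a b) :
    ∃ a' ∈ G.comp (S \ {x₁, x₂}) a, G.Adj x₂ a' := by
  have hA : ∀ w, w ∈ S ∧ G.Adj x₁ w ↔ w = a ∨ w = b := fun w ↦ by
    rw [← mem_nb, hnb, Finset.mem_insert, Finset.mem_singleton]
  have ha := (hA a).2 (.inl rfl)
  have haS : a ∈ S \ {x₁, x₂} := by simp [ha.1, ha.2.ne', hax]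
  have hsub : G.comp (S \ {x₁, x₂}) a ⊆ S \ {x₁, x₂} := comp_subset
  obtain ⟨v, hv, w, hw, hwA, hadj, hne⟩ := hS.exists_exit (hsub.trans Finset.sdiff_subset)
    ⟨a, mem_comp.2 (.refl haS)⟩ (fun h ↦ by simpa using hsub h) (fun h ↦ by simpa using hsub h)
    a x₁
  have hw' : w = x₁ ∨ w = x₂ := by
    by_contra hcon
    exact hwA (mem_comp_of_adj hv (by simpa [hw] using hcon) hadj)
  rcases hw' with rfl | rfl
  · rcases (hA v).1 ⟨(Finset.mem_sdiff.1 (hsub hv)).1, hadj.symm⟩ with rfl | rfl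
    · simp at hne
    · exact absurd (mem_comp.1 hv) hr
  · exact ⟨v, hv, hadj.symm⟩

/-- If no cycle through `x₁` avoids `x₂`, then deleting both leaves two regions. -/
theorem Region.split (hS : G.Region S x₁ x₂) {a b : V} (hne : x₁ ≠ x₂) (hnadj : ¬ G.Adj x₁ x₂)
    (hnb : G.nb S x₁ = {a, b}) (h₂ : G.wdeg S x₁ x₂ x₂ ≠ 2)
    (hr : ¬ G.Reach (S \ {x₁, x₂}) a b) :
    ∃ (A B : Finset V) (a' b' : V), Disjoint A B ∧ A ∪ B = S \ {x₁, x₂} ∧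
      G.Adj x₁ a ∧ G.Adj x₁ b ∧ G.Adj x₂ a' ∧ G.Adj x₂ b' ∧
      G.Region A a a' ∧ G.Region B b b' ∧
      (∀ v ∈ A, G.wdeg A a a' v = G.wdeg S x₁ x₂ v) ∧
      (∀ v ∈ B, G.wdeg B b b' v = G.wdeg S x₁ x₂ v) := by
  have hA : ∀ w, w ∈ S ∧ G.Adj x₁ w ↔ w = a ∨ w = b := fun w ↦ by
    rw [← mem_nb, hnb, Finset.mem_insert, Finset.mem_singleton]
  have ha := (hA a).2 (.inl rfl)
  have hb := (hA b).2 (.inr rfl)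
  have hax : a ≠ x₂ := fun h ↦ hnadj (h ▸ ha.2)
  have hbx : b ≠ x₂ := fun h ↦ hnadj (h ▸ hb.2)
  have haS : a ∈ S \ {x₁, x₂} := by simp [ha.1, ha.2.ne', hax]
  have hbS : b ∈ S \ {x₁, x₂} := by simp [hb.1, hb.2.ne', hbx]
  obtain ⟨a', ha'A, ha'⟩ := hS.exists_adj_right_of_comp hnb hax hr
  obtain ⟨b', hb'B, hb'⟩ := hS.exists_adj_right_of_comp (Finset.pair_comm a b ▸ hnb) hbx
    fun h ↦ hr h.symm
  have hsubA : G.comp (S \ {x₁, x₂}) a ⊆ S \ {x₁, x₂} := comp_subset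
  have hsubB : G.comp (S \ {x₁, x₂}) b ⊆ S \ {x₁, x₂} := comp_subset
  have hdisj : Disjoint (G.comp (S \ {x₁, x₂}) a) (G.comp (S \ {x₁, x₂}) b) := by
    rw [Finset.disjoint_left]
    intro v hva hvb
    exact hr ((mem_comp.1 hva).trans (mem_comp.1 hvb).symm)
  have hab' : a' ≠ b' := fun h ↦ Finset.disjoint_left.1 hdisj ha'A (h ▸ hb'B)
  have hab : a ≠ b := fun h ↦ hr (h ▸ .refl haS)
  have haB : a ∉ G.comp (S \ {x₁, x₂}) b := fun h ↦ hr (mem_comp.1 h).symm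
  have hbA : b ∉ G.comp (S \ {x₁, x₂}) a := fun h ↦ hr (mem_comp.1 h)
  -- Beside its half-edge, `x₂` has only two neighbours in `S`, hence exactly one in each component.
  have hB : ∀ w, w ∈ S ∧ G.Adj x₂ w ↔ w = a' ∨ w = b' := by
    rw [wdeg_comm] at h₂
    obtain ⟨p, q, hpq, hpqnb⟩ := hS.symm.exists_nb_eq_pair hne.symm h₂
    have hsub : ({a', b'} : Finset V) ⊆ G.nb S x₂ := by
      rw [Finset.insert_subset_iff, Finset.singleton_subset_iff, mem_nb, mem_nb]
      exact ⟨⟨(Finset.mem_sdiff.1 (hsubA ha'A)).1, ha'⟩, (Finset.mem_sdiff.1 (hsubB hb'B)).1, hb'⟩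
    have heq := Finset.eq_of_subset_of_card_le hsub (by
      rw [hpqnb, Finset.card_pair hpq, Finset.card_pair hab'])
    intro w
    rw [← mem_nb, ← heq, Finset.mem_insert, Finset.mem_singleton]
  have key : ∀ {f f' g g' : V}, f ∈ S \ {x₁, x₂} → f' ∈ G.comp (S \ {x₁, x₂}) f →
      g ∉ G.comp (S \ {x₁, x₂}) f → g' ∉ G.comp (S \ {x₁, x₂}) f →
      (∀ w, w ∈ S ∧ G.Adj x₁ w ↔ w = f ∨ w = g) → (∀ w, w ∈ S ∧ G.Adj x₂ w ↔ w = f' ∨ w = g') →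
      G.Region (G.comp (S \ {x₁, x₂}) f) f f' ∧ ∀ v ∈ G.comp (S \ {x₁, x₂}) f,
        G.wdeg (G.comp (S \ {x₁, x₂}) f) f f' v = G.wdeg S x₁ x₂ v := by
    intro f f' g g' hf hf' hg hg' hF hF'
    have hsubF : G.comp (S \ {x₁, x₂}) f ⊆ S \ {x₁, x₂} := comp_subset
    have hFS := hsubF.trans Finset.sdiff_subset
    have h1 : x₁ ∉ G.comp (S \ {x₁, x₂}) f := fun h ↦ by simpa using hsubF h
    have h2 : x₂ ∉ G.comp (S \ {x₁, x₂}) f := fun h ↦ by simpa using hsubF h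
    have hex := exits_card (G := G) (S := S) (r := f) (r' := f') (p := x₁) (q := x₂)
      (Finset.mem_sdiff.2 ⟨hS.left_mem, h1⟩) (Finset.mem_sdiff.2 ⟨hS.right_mem, h2⟩) hne h1 h2 (by
        intro v hv w hw
        rw [Finset.mem_sdiff] at hw
        have hvg : v ≠ g := fun h ↦ hg (h ▸ hv)
        have hvg' : v ≠ g' := fun h ↦ hg' (h ▸ hv)
        have e1 := hF v
        have e2 := hF' v
        simp only [hFS hv, true_and, hvg, hvg', or_false] at e1 e2
        by_cases hwx : w = x₁ ∨ w = x₂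
        · rcases hwx with rfl | rfl
          · rw [G.adj_comm, e1]
            simp [hne]
          · rw [G.adj_comm, e2]
            simp [hne.symm]
        · constructor
          · intro hadj
            exact absurd (mem_comp_of_adj hv (by simpa [hw.1] using hwx) hadj) hw.2
          · tauto)
    exact ⟨hS.sub hFS (mem_comp.2 (.refl hf)) hf' hex, fun v hv ↦ wdeg_sub hFS (hex v hv)⟩
  obtain ⟨rA, wA⟩ := key haS ha'A hbA (Finset.disjoint_right.1 hdisj hb'B) hA hB
  obtain ⟨rB, wB⟩ := key hbS hb'B haB (Finset.disjoint_left.1 hdisj ha'A)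
    (fun w ↦ (hA w).trans or_comm) fun w ↦ (hB w).trans or_comm
  refine ⟨_, _, a', b', hdisj, ?_, ha.2, hb.2, ha', hb', rA, rB, wA, wB⟩
  -- A third component would have to be left through `x₁` or `x₂`, but all their neighbours are
  -- already used up.
  refine Finset.Subset.antisymm (Finset.union_subset hsubA hsubB) fun v hv ↦ ?_
  by_contra hvn
  rw [Finset.mem_union, not_or, mem_comp, mem_comp] at hvn
  have hsubC : G.comp (S \ {x₁, x₂}) v ⊆ S \ {x₁, x₂} := comp_subset
  obtain ⟨s, hs, w, hw, hwC, hadj, -⟩ := hS.exists_exit (hsubC.trans Finset.sdiff_subset)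
    ⟨v, mem_comp.2 (.refl hv)⟩ (fun h ↦ by simpa using hsubC h) (fun h ↦ by simpa using hsubC h)
    x₁ x₁
  have hsS := (Finset.mem_sdiff.1 (hsubC hs)).1
  rw [mem_comp] at hs
  have hw' : w = x₁ ∨ w = x₂ := by
    by_contra hcon
    exact hwC (mem_comp_of_adj (mem_comp.2 hs) (by simpa [hw] using hcon) hadj)
  rcases hw' with rfl | rfl
  · rcases (hA s).1 ⟨hsS, hadj.symm⟩ with rfl | rfl
    · exact hvn.1 hs.symm
    · exact hvn.2 hs.symm
  · rcases (hB s).1 ⟨hsS, hadj.symm⟩ with rfl | rfl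
    · exact hvn.1 ((mem_comp.1 ha'A).trans hs.symm)
    · exact hvn.2 ((mem_comp.1 hb'B).trans hs.symm)

/-- A cycle `c 0, …, c m` through `x₁ = c 0 = c m` together with a connected set `D` that contains
`x₂`, avoids the cycle, and is maximal in the sense that no vertex next to `D` can be added to it
without destroying all such cycles. -/
structure Necklace (G : SimpleGraph V) [DecidableRel G.Adj] (S : Finset V) (x₁ x₂ : V)
    (D : Finset V) (m : ℕ) (c : ℕ → V) : Prop where
  region : G.Region S x₁ x₂
  subset : D ⊆ S
  right_mem : x₂ ∈ D
  conn : ∀ v ∈ D, G.Reach D v x₂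
  zero : c 0 = x₁
  last : c m = x₁
  three_le : 3 ≤ m
  inj : Set.InjOn c (Set.Iio m)
  mem : ∀ t ≤ m, c t ∈ S \ D
  adj : ∀ t < m, G.Adj (c t) (c (t + 1))
  nb_left : ∀ w ∈ S, G.Adj x₁ w → w = c 1 ∨ w = c (m - 1)
  conn' : ∀ v ∈ S \ D, v ≠ x₁ → G.Reach ((S \ D) \ {x₁}) (c 1) v
  sep : ∀ u ∈ S \ D, u ≠ x₁ → (∃ d ∈ D, G.Adj d u) →
    ¬ G.Reach (((S \ D) \ {x₁}) \ {u}) (c 1) (c (m - 1))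

/-- Positions `0` and `m` both stand for `x`, so the arcs from `x` in either direction are intervals
of indices. -/
theorem exists_cycle_seq {T : Finset V} {x a b : V} (hab : a ≠ b) (hx : x ∉ T) (hxa : G.Adj x a)
    (hxb : G.Adj x b) (h : G.Reach T a b) :
    ∃ (m : ℕ) (c : ℕ → V), 3 ≤ m ∧ c 0 = x ∧ c m = x ∧ c 1 = a ∧ c (m - 1) = b ∧
      Set.InjOn c (Set.Iio m) ∧ (∀ t, 0 < t → t < m → c t ∈ T) ∧
      ∀ t < m, G.Adj (c t) (c (t + 1)) := by
  obtain ⟨p₀, hp₀⟩ := h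
  obtain ⟨p, hp, hpT⟩ : ∃ p : G.Walk a b, p.IsPath ∧ ∀ w ∈ p.support, w ∈ T :=
    ⟨p₀.toPath.1, p₀.toPath.2, fun w hw ↦ hp₀ w (p₀.support_toPath_subset_support hw)⟩
  have hlen : 1 ≤ p.length := by
    by_contra hcon
    exact hab (Walk.eq_of_length_eq_zero (p := p) (by omega))
  have hxp : x ∉ p.support := fun h ↦ hx (hpT x h)
  have hcyc : (Walk.cons hxa (p.concat hxb.symm)).IsCycle := by
    rw [Walk.cons_isCycle_iff]
    refine ⟨hp.concat hxp hxb.symm, ?_⟩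
    rw [Walk.edges_concat, List.concat_eq_append, List.mem_append, List.mem_singleton]
    rintro (h | h)
    · exact hxp (p.fst_mem_support_of_mem_edges h)
    · rw [Sym2.eq_iff] at h
      rcases h with h | h
      · exact hxb.ne h.1
      · exact hab h.2
  refine ⟨p.length + 2, (Walk.cons hxa (p.concat hxb.symm)).getVert, by omega, by simp, ?_, by simp,
    ?_, ?_, ?_, ?_⟩
  · exact Walk.getVert_of_length_le _ (by simp)
  · simp [Walk.concat_eq_append, Walk.getVert_append]
  · refine hcyc.getVert_injOn'.mono fun t ht ↦ ?_
    simp only [Set.mem_Iio, Set.mem_ofPred_eq, Walk.length_cons, Walk.length_concat] at ht ⊢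
    omega
  · intro t h0 ht
    obtain ⟨t, rfl⟩ := Nat.exists_eq_add_of_lt h0
    rw [Nat.zero_add, Walk.getVert_cons_succ, Walk.concat_eq_append, Walk.getVert_append]
    split_ifs with h
    · exact hpT _ (p.getVert_mem_support t)
    · have : t = p.length := by omega
      subst this
      simpa using hpT b p.end_mem_support
  · intro t ht
    exact Walk.adj_getVert_succ _ (by simp; omega)

/-- `D` is chosen of maximum size among the connected supersets of `D₀` that leave a cycle through
`x₁`. Maximality gives both `conn'` and `sep`. -/
theorem Region.exists_necklace (hS : G.Region S x₁ x₂) {a b : V} (hab : a ≠ b)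
    (hnb : G.nb S x₁ = {a, b}) {D₀ : Finset V} (hD₀ : D₀ ⊆ S) (hx₁ : x₁ ∉ D₀) (hx₂ : x₂ ∈ D₀)
    (hconn : ∀ v ∈ D₀, G.Reach D₀ v x₂) (hr : G.Reach ((S \ D₀) \ {x₁}) a b) :
    ∃ D m c, D₀ ⊆ D ∧ G.Necklace S x₁ x₂ D m c := by
  classical
  let F := S.powerset.filter fun D ↦ D₀ ⊆ D ∧ x₁ ∉ D ∧ (∀ v ∈ D, G.Reach D v x₂) ∧
    G.Reach ((S \ D) \ {x₁}) a b
  obtain ⟨D, hDF, hmax⟩ := F.exists_max_image Finset.card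
    ⟨D₀, by simp only [F, Finset.mem_filter, Finset.mem_powerset]; exact ⟨hD₀, subset_rfl, hx₁, hconn, hr⟩⟩
  simp only [F, Finset.mem_filter, Finset.mem_powerset] at hDF hmax
  obtain ⟨hDS, hD₀D, hx₁D, hDconn, hDr⟩ := hDF
  have hA : ∀ w, w ∈ S ∧ G.Adj x₁ w ↔ w = a ∨ w = b := fun w ↦ by
    rw [← mem_nb, hnb, Finset.mem_insert, Finset.mem_singleton]
  have hmax' : ∀ N ⊆ (S \ D) \ {x₁}, (∀ v ∈ N, G.Reach (D ∪ N) v x₂) →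
      G.Reach (((S \ D) \ {x₁}) \ N) a b → N = ∅ := by
    intro N hN hNconn hNr
    have hdis : Disjoint D N := Finset.disjoint_left.2 fun v hvD hvN ↦ by
      have := hN hvN
      simp_all
    have := hmax (D ∪ N) ⟨Finset.union_subset hDS (hN.trans (Finset.sdiff_subset.trans
      Finset.sdiff_subset)), hD₀D.trans Finset.subset_union_left, ?_, ?_, ?_⟩
    · rw [Finset.card_union_of_disjoint hdis] at this
      exact Finset.card_eq_zero.1 (by omega)
    · intro h
      rcases Finset.mem_union.1 h with h | h
      · exact hx₁D h
      · simpa using hN h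
    · intro v hv
      rcases Finset.mem_union.1 hv with h | h
      · exact (hDconn v h).mono Finset.subset_union_left
      · exact hNconn v h
    · refine hNr.mono fun v ↦ ?_
      simp only [Finset.mem_sdiff, Finset.mem_union]
      tauto
  obtain ⟨m, c, hm, h0, hlast, h1, hm1, hinj, hmem, hadj⟩ := exists_cycle_seq hab
    (by simp) ((hA a).2 (.inl rfl)).2 ((hA b).2 (.inr rfl)).2 hDr
  refine ⟨D, m, c, hD₀D, hS, hDS, hD₀D hx₂, hDconn, h0, hlast, hm, hinj, ?_, hadj, ?_, ?_, ?_⟩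
  · intro t ht
    by_cases ht0 : t = 0
    · rw [ht0, h0]
      simp [hS.left_mem, hx₁D]
    by_cases htm : t = m
    · rw [htm, hlast]
      simp [hS.left_mem, hx₁D]
    exact Finset.sdiff_subset (hmem t (by omega) (by omega))
  · intro w hw hadj
    rw [h1, hm1]
    exact (hA w).1 ⟨hw, hadj⟩
  · intro v hv hvx
    rw [h1]
    -- A component missing the cycle has an exit, which can only lead into `D`; adding the component
    -- to `D` would contradict maximality.
    by_contra hcon
    have hvM : v ∈ (S \ D) \ {x₁} := Finset.mem_sdiff.2 ⟨hv, by simpa using hvx⟩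
    have hsub : G.comp ((S \ D) \ {x₁}) v ⊆ (S \ D) \ {x₁} := comp_subset
    have hsubS := hsub.trans (Finset.sdiff_subset.trans Finset.sdiff_subset)
    obtain ⟨s, hs, w, hw, hwC, hsw, -⟩ := hS.exists_exit hsubS
      ⟨v, mem_comp.2 (.refl hvM)⟩ (fun h ↦ by simpa using hsub h)
      (fun h ↦ by have := hsub h; simp [hD₀D hx₂] at this) x₁ x₁
    have hwD : w ∈ D := by
      by_contra hwD
      by_cases hwx : w = x₁
      · subst hwx
        rcases (hA s).1 ⟨hsubS hs, hsw.symm⟩ with rfl | rfl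
        · exact hcon (mem_comp.1 hs).symm
        · exact hcon (hDr.trans (mem_comp.1 hs).symm)
      · exact hwC (mem_comp_of_adj hs (by simp [hw, hwD, hwx]) hsw)
    have hempty := hmax' _ hsub (fun u hu ↦ ?_) ?_
    · rw [hempty] at hs
      simp at hs
    · refine ((reach_comp_of_mem hu hs).mono Finset.subset_union_right).trans ?_
      exact (Reach.of_adj hsw (by simp [hs]) (by simp [hwD])).trans
        ((hDconn w hwD).mono Finset.subset_union_left)
    · refine hDr.in_comp.mono fun u hu ↦ ?_
      refine Finset.mem_sdiff.2 ⟨comp_subset hu, fun hu' ↦ ?_⟩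
      exact hcon ((mem_comp.1 hu).trans (mem_comp.1 hu').symm)
  · rintro u hu hux ⟨d, hd, hdu⟩ hreach
    rw [h1, hm1] at hreach
    have := hmax' {u} (by simpa [hux] using hu) ?_ hreach
    · simp at this
    · intro v hv
      rw [Finset.mem_singleton] at hv
      subst hv
      exact (Reach.of_adj hdu.symm (by simp) (by simp [hd])).trans
        ((hDconn d hd).mono Finset.subset_union_left)

end Necklaces

/-! ### The structure of a necklace -/

section NecklaceLemmas

variable {V : Type*} [DecidableEq V] {G : SimpleGraph V} [DecidableRel G.Adj]
variable {S R D : Finset V} {x₁ x₂ : V} {m : ℕ} {c : ℕ → V}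

/-- `u` has a neighbour in `D`. -/
def Att (G : SimpleGraph V) (D : Finset V) (u : V) : Prop := ∃ d ∈ D, G.Adj d u

/-- The vertices of `S` other than `x` that neither lie in `D` nor have a neighbour there. -/
def core (G : SimpleGraph V) [DecidableRel G.Adj] (S D : Finset V) (x : V) : Finset V :=
  (S \ D).filter fun v ↦ v ≠ x ∧ ∀ d ∈ D, ¬ G.Adj d v

theorem mem_core {x v : V} : v ∈ G.core S D x ↔ v ∈ S \ D ∧ v ≠ x ∧ ¬ G.Att D v := by
  simp [core, Att]

namespace Necklace

variable (N : G.Necklace S x₁ x₂ D m c)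
include N

theorem ne_left {t : ℕ} (h0 : 0 < t) (ht : t < m) : c t ≠ x₁ := by
  intro h
  rw [← N.zero] at h
  have := N.inj (Set.mem_Iio.2 ht) (Set.mem_Iio.2 (by omega)) h
  omega

theorem left_notMem : x₁ ∉ D := by
  have := N.mem 0 (Nat.zero_le _)
  rw [N.zero] at this
  exact (Finset.mem_sdiff.1 this).2

theorem ne_ends : x₁ ≠ x₂ := fun h ↦ N.left_notMem (h ▸ N.right_mem)

theorem ne_right {t : ℕ} (ht : t ≤ m) : c t ≠ x₂ := fun h ↦
  (Finset.mem_sdiff.1 (N.mem t ht)).2 (h ▸ N.right_mem)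

theorem inj' : Set.InjOn c (Set.Ioc 0 m) := by
  intro s hs t ht hst
  rw [Set.mem_Ioc] at hs ht
  rcases hs.2.lt_or_eq with hs' | rfl
  · rcases ht.2.lt_or_eq with ht' | rfl
    · exact N.inj hs' ht' hst
    · exact absurd (hst.trans N.last) (N.ne_left hs.1 hs')
  · rcases ht.2.lt_or_eq with ht' | rfl
    · exact absurd (hst.symm.trans N.last) (N.ne_left ht.1 ht')
    · rfl

theorem eq_of_eq {s t : ℕ} (hs : s ≤ m) (ht : t ≤ m) (h0 : 0 < s) (hm : s < m)
    (h : c s = c t) : s = t := by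
  rcases Nat.eq_zero_or_pos t with rfl | ht0
  · exact absurd (h.trans N.zero) (N.ne_left h0 hm)
  · exact N.inj' ⟨h0, hs⟩ ⟨ht0, ht⟩ h

/-- By `sep`, the arc from `c 1` to `c (m - 1)` cannot avoid an attachment. -/
theorem exists_index {u : V} (hu : u ∈ S \ D) (hux : u ≠ x₁) (ha : G.Att D u) :
    ∃ t, 0 < t ∧ t < m ∧ c t = u := by
  by_contra! hcon
  have := N.three_le
  refine N.sep u hu hux ha (Reach.of_seq (by omega) (fun k h1 h2 ↦ N.adj k (by omega)) ?_)
  intro k h1 h2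
  simp [-Finset.mem_sdiff, Finset.mem_sdiff (s := _ \ {x₁}), Finset.mem_sdiff (t := {x₁}),
    N.mem k (by omega), N.ne_left (t := k) (by omega) (by omega), hcon k (by omega) (by omega)]

theorem not_att_left : ¬ G.Att D x₁ := by
  rintro ⟨d, hd, hadj⟩
  have := N.three_le
  rcases N.nb_left d (N.subset hd) hadj.symm with rfl | rfl
  · exact (Finset.mem_sdiff.1 (N.mem 1 (by omega))).2 hd
  · exact (Finset.mem_sdiff.1 (N.mem (m - 1) (by omega))).2 hd

/-- The half-edge at `x₂` is only one of the two exits that `D` must have. -/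
theorem exists_att : ∃ t, 0 < t ∧ t < m ∧ G.Att D (c t) := by
  obtain ⟨v, hv, w, hw, hwD, hadj⟩ :=
    N.region.exists_exit_of_right_mem N.subset N.left_notMem N.right_mem
  have hatt : G.Att D w := ⟨v, hv, hadj⟩
  obtain ⟨t, h0, hm, rfl⟩ := N.exists_index (Finset.mem_sdiff.2 ⟨hw, hwD⟩)
    (fun h ↦ N.not_att_left (h ▸ hatt)) hatt
  exact ⟨t, h0, hm, hatt⟩

/-- A vertex of the cycle next to `D` has exactly three neighbours. -/
theorem nb_att {t : ℕ} (h0 : 0 < t) (ht : t < m) {d : V} (hd : d ∈ D) (hadj : G.Adj d (c t)) :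
    G.nb S (c t) = {c (t - 1), c (t + 1), d} ∧ c (t - 1) ≠ c (t + 1) ∧
      G.wdeg S x₁ x₂ (c t) = 3 := by
  have h1 := Finset.mem_sdiff.1 (N.mem (t - 1) (by omega))
  have h2 := Finset.mem_sdiff.1 (N.mem (t + 1) (by omega))
  have h3 := Finset.mem_sdiff.1 (N.mem t (by omega))
  have := N.three_le
  have hne : c (t - 1) ≠ c (t + 1) := by
    intro h
    by_cases h1 : t = 1
    · have := N.eq_of_eq (by omega) (by omega) (by omega) (by omega) h.symm
      omega
    · have := N.eq_of_eq (by omega) (by omega) (by omega) (by omega) h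
      omega
  have hd1 : c (t - 1) ≠ d := fun h ↦ h1.2 (h ▸ hd)
  have hd2 : c (t + 1) ≠ d := fun h ↦ h2.2 (h ▸ hd)
  have hport : port x₁ x₂ (c t) = 0 := by simp [port, N.ne_left h0 ht, N.ne_right ht.le]
  have hsub : ({c (t - 1), c (t + 1), d} : Finset V) ⊆ G.nb S (c t) := by
    simp only [Finset.insert_subset_iff, Finset.singleton_subset_iff, mem_nb]
    refine ⟨⟨h1.1, ?_⟩, ⟨h2.1, N.adj t ht⟩, N.subset hd, hadj.symm⟩
    have := N.adj (t - 1) (by omega)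
    rw [Nat.sub_add_cancel h0] at this
    exact this.symm
  have hcard : ({c (t - 1), c (t + 1), d} : Finset V).card = 3 :=
    Finset.card_eq_three.2 ⟨_, _, _, hne, hd1, hd2, rfl⟩
  have hle := N.region.wdeg_le _ h3.1
  rw [wdeg, hport, Nat.add_zero] at hle
  have heq := Finset.eq_of_subset_of_card_le hsub (by omega)
  refine ⟨heq.symm, hne, ?_⟩
  rw [wdeg, hport, ← heq, hcard]

theorem eq_of_adj_att {t : ℕ} (h0 : 0 < t) (ht : t < m) (ha : G.Att D (c t)) {w : V} (hw : w ∈ S)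
    (hwD : w ∉ D) (hadj : G.Adj (c t) w) : w = c (t - 1) ∨ w = c (t + 1) := by
  obtain ⟨d, hd, hda⟩ := ha
  have hmem : w ∈ G.nb S (c t) := mem_nb.2 ⟨hw, hadj⟩
  rw [(N.nb_att h0 ht hd hda).1] at hmem
  simp only [Finset.mem_insert, Finset.mem_singleton] at hmem
  rcases hmem with h | h | h
  · exact .inl h
  · exact .inr h
  · exact absurd (h ▸ hd) hwD

theorem mem_core_seq {t : ℕ} (h0 : 0 < t) (ht : t < m) (ha : ¬ G.Att D (c t)) :
    c t ∈ G.core S D x₁ :=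
  mem_core.2 ⟨N.mem t ht.le, N.ne_left h0 ht, ha⟩

/-- Along a walk from `c 1` to `v`, each step out of an attachment leads back to the cycle, because
cubic attachments have no other neighbours outside `D`. The part after the last attachment stays in
the core. -/
theorem reach_core {v : V} (hv : v ∈ S \ D) (hvx : v ≠ x₁) (ha : ¬ G.Att D v) :
    ∃ t, 0 < t ∧ t < m ∧ G.Reach (G.core S D x₁) v (c t) := by
  have := N.three_le
  refine (N.conn' v hv hvx).induction
    (P := fun v ↦ ¬ G.Att D v → ∃ t, 0 < t ∧ t < m ∧ G.Reach (G.core S D x₁) v (c t)) ?_ ?_ ha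
  · exact fun h ↦ ⟨1, by omega, by omega, .refl (N.mem_core_seq (by omega) (by omega) h)⟩
  · intro w hw v hv hPw hadj hav
    rw [Finset.mem_sdiff, Finset.mem_singleton] at hw hv
    have hvcore : v ∈ G.core S D x₁ := mem_core.2 ⟨hv.1, hv.2, hav⟩
    by_cases haw : G.Att D w
    · obtain ⟨t, h0, ht, rfl⟩ := N.exists_index hw.1 hw.2 haw
      have hv1 := Finset.mem_sdiff.1 hv.1
      rcases N.eq_of_adj_att h0 ht haw hv1.1 hv1.2 hadj with rfl | rfl
      · refine ⟨t - 1, Nat.pos_of_ne_zero fun h ↦ hv.2 ?_, by omega, .refl hvcore⟩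
        rw [h, N.zero]
      · refine ⟨t + 1, by omega, lt_of_le_of_ne ht fun h ↦ hv.2 ?_, .refl hvcore⟩
        rw [← N.last, ← h]
    · obtain ⟨t, h0, ht, hr⟩ := hPw haw
      exact ⟨t, h0, ht, (Reach.of_adj hadj.symm hvcore (mem_core.2 ⟨hw.1, hw.2, haw⟩)).trans hr⟩

theorem hasPath_prefix {t : ℕ} (ht : t < m) :
    G.HasPath ((Finset.Icc 0 t).image c) x₁ (c t) t := by
  refine ⟨_, subset_rfl, ?_⟩
  have := PathOn.of_seq (G := G) (c := c) (Nat.zero_le t) (fun k _ hk ↦ N.adj k (by omega))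
    (N.inj.mono fun k hk ↦ Set.mem_Iio.2 (hk.2.trans_lt ht))
  rwa [N.zero, Nat.sub_zero] at this

theorem hasPath_suffix {t : ℕ} (h0 : 0 < t) (ht : t ≤ m) :
    G.HasPath ((Finset.Icc t m).image c) x₁ (c t) (m - t) := by
  refine ⟨_, subset_rfl, PathOn.reverse ?_⟩
  have := PathOn.of_seq (G := G) (c := c) ht (fun k _ hk ↦ N.adj k hk)
    (N.inj'.mono fun k hk ↦ Set.mem_Ioc.2 ⟨h0.trans_le hk.1, hk.2⟩)
  rwa [N.last] at this

theorem hasPath_att {t : ℕ} (ht : t ≤ m) (ha : G.Att D (c t)) :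
    ∃ n, G.HasPath ({c t} ∪ D) (c t) x₂ n := by
  obtain ⟨d, hd, hadj⟩ := ha
  obtain ⟨k, hk⟩ := (N.conn d hd).exists_hasPath
  refine ⟨_, (HasPath.single (Finset.mem_singleton_self _)).append hk hadj.symm ?_
    Finset.subset_union_left Finset.subset_union_right⟩
  exact Finset.disjoint_singleton_left.2 (Finset.mem_sdiff.1 (N.mem t ht)).2

theorem image_subset {s t : ℕ} (ht : t ≤ m) : (Finset.Icc s t).image c ⊆ S \ D := by
  intro v hv
  obtain ⟨k, hk, rfl⟩ := Finset.mem_image.1 hv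
  exact N.mem k ((Finset.mem_Icc.1 hk).2.trans ht)

/-- Going around the cycle in both directions to a central attachment. -/
theorem closeLengths_of_att {t : ℕ} (h0 : 0 < t) (ht : t < m) (ha : G.Att D (c t))
    (hc : m = 2 * t + 1 ∨ m = 2 * t + 2 ∨ 2 * t = m + 1 ∨ 2 * t = m + 2) :
    G.CloseLengths S x₁ x₂ := by
  obtain ⟨d, hd, hadj⟩ := ha
  obtain ⟨k, hk⟩ := (N.conn d hd).exists_hasPath
  -- The arcs have lengths `t` and `m - t` and share the continuation through `D`; `hc` says that
  -- these lengths differ by one or two.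
  have p₁ := (N.hasPath_prefix ht).append (X := S) hk hadj.symm
    (Finset.disjoint_of_subset_left (N.image_subset ht.le) Finset.sdiff_disjoint)
    ((N.image_subset ht.le).trans Finset.sdiff_subset) N.subset
  have p₂ := (N.hasPath_suffix h0 ht.le).append (X := S) hk hadj.symm
    (Finset.disjoint_of_subset_left (N.image_subset le_rfl) Finset.sdiff_disjoint)
    ((N.image_subset le_rfl).trans Finset.sdiff_subset) N.subset
  rcases hc with hc | hc | hc | hc
  · exact ⟨_, _, p₁, p₂, by omega⟩
  · exact ⟨_, _, p₁, p₂, by omega⟩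
  · exact ⟨_, _, p₂, p₁, by omega⟩
  · exact ⟨_, _, p₂, p₁, by omega⟩

end Necklace

/-- Two positions on the cycle of a necklace, each one `x₁` or next to `D`, without attachments
strictly between them. -/
structure Gap (G : SimpleGraph V) (D : Finset V) (m : ℕ) (c : ℕ → V) (i l : ℕ) : Prop where
  lt : i + 1 < l
  le : l ≤ m
  left : i = 0 ∨ G.Att D (c i)
  right : l = m ∨ G.Att D (c l)
  ne : 0 < i ∨ l < m
  between : ∀ t, i < t → t < l → ¬ G.Att D (c t)

/-! ### Gaps of a necklace as regions -/

namespace Necklace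

variable {i l : ℕ} (N : G.Necklace S x₁ x₂ D m c) (g : G.Gap D m c i l)
include N g

theorem gap_mem {t : ℕ} (hi : i < t) (hl : t < l) :
    c t ∈ G.comp (G.core S D x₁) (c (i + 1)) := by
  have := g.le
  exact mem_comp.2 (Reach.of_seq hi (fun k h1 h2 ↦ N.adj k (by omega)) fun k h1 h2 ↦
    N.mem_core_seq (by omega) (by omega) (g.between k (by omega) (by omega)))

/-- A core walk from the gap to a cycle vertex beyond one of its ends would bypass the attachment
there, against `sep`. -/
theorem gap_notMem {t : ℕ} (htm : t ≤ m) (h : t ≤ i ∨ l ≤ t) :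
    c t ∉ G.comp (G.core S D x₁) (c (i + 1)) := by
  intro hmem
  have hcore := mem_core.1 (comp_subset hmem)
  have h0 : 0 < t := Nat.pos_of_ne_zero fun h ↦ hcore.2.1 (by rw [h, N.zero])
  have hm : t < m := lt_of_le_of_ne htm fun h ↦ hcore.2.1 (by rw [h, N.last])
  have hgl := g.lt
  have hgm := g.le
  have hreach := mem_comp.1 hmem
  have hsub : ∀ {u}, G.Att D u → G.core S D x₁ ⊆ ((S \ D) \ {x₁}) \ {u} := by
    intro u hu v hv
    rw [mem_core] at hv
    refine Finset.mem_sdiff.2 ⟨Finset.mem_sdiff.2 ⟨hv.1, by simpa using hv.2.1⟩, ?_⟩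
    rw [Finset.mem_singleton]
    rintro rfl
    exact hv.2.2 hu
  have hseq : ∀ {s : ℕ}, 0 < s → s < m → ∀ k, 0 < k → k < m → k ≠ s →
      c k ∈ ((S \ D) \ {x₁}) \ {c s} := by
    intro s hs hsm k hk hkm hks
    refine Finset.mem_sdiff.2 ⟨Finset.mem_sdiff.2 ⟨N.mem k hkm.le, ?_⟩, ?_⟩
    · simpa using N.ne_left hk hkm
    · rw [Finset.mem_singleton]
      exact fun h ↦ hks (N.eq_of_eq hkm.le hsm.le hk hkm h)
  rcases h with h | h
  · rcases h.lt_or_eq with h | rfl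
    · have ha := g.left.resolve_left (by omega)
      refine N.sep (c i) (N.mem i (by omega)) (N.ne_left (by omega) (by omega)) ha ?_
      refine ((Reach.of_seq h0 (fun k h1 h2 ↦ N.adj k (by omega)) fun k h1 h2 ↦ ?_).trans
        (hreach.symm.mono (hsub ha))).trans
        (Reach.of_seq (by omega) (fun k h1 h2 ↦ N.adj k (by omega)) fun k h1 h2 ↦ ?_)
      all_goals exact hseq (by omega) (by omega) k (by omega) (by omega) (by omega)
    · exact hcore.2.2 (g.left.resolve_left (by omega))
  · rcases h.lt_or_eq with h | rfl
    · have ha := g.right.resolve_left (by omega)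
      refine N.sep (c l) (N.mem l (by omega)) (N.ne_left (by omega) (by omega)) ha ?_
      refine ((Reach.of_seq (by omega) (fun k h1 h2 ↦ N.adj k (by omega)) fun k h1 h2 ↦ ?_).trans
        (hreach.mono (hsub ha))).trans
        (Reach.of_seq (by omega) (fun k h1 h2 ↦ N.adj k (by omega)) fun k h1 h2 ↦ ?_)
      all_goals exact hseq (by omega) (by omega) k (by omega) (by omega) (by omega)
    · exact hcore.2.2 (g.right.resolve_left (by omega))

/-- A core component can only be left towards `x₁` or an attachment. Outside `D` these are adjacent
only to their neighbours on the cycle, so the exits are the two cycle edges bounding the gap. -/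
theorem gap_exits : ∀ v ∈ G.comp (G.core S D x₁) (c (i + 1)),
    ∀ w ∈ S \ G.comp (G.core S D x₁) (c (i + 1)),
      G.Adj v w ↔ v = c (i + 1) ∧ w = c i ∨ v = c (l - 1) ∧ w = c l := by
  have hgl := g.lt
  have hgm := g.le
  intro v hv w hw
  rw [Finset.mem_sdiff] at hw
  have hvcore := mem_core.1 (comp_subset hv)
  constructor
  · intro hadj
    have hwD : w ∉ D := fun h ↦ hvcore.2.2 ⟨w, h, hadj.symm⟩
    have key : ∀ s ≤ m, v = c s → (w = c (s - 1) ∧ 0 < s ∨ w = c (s + 1) ∧ s < m) →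
        v = c (i + 1) ∧ w = c i ∨ v = c (l - 1) ∧ w = c l := by
      rintro s hs rfl hws
      have hs' : i < s ∧ s < l := by
        by_contra hcon
        exact N.gap_notMem g hs (by omega) hv
      rcases hws with ⟨rfl, -⟩ | ⟨rfl, -⟩
      · have : s = i + 1 := by
          by_contra hcon
          exact hw.2 (N.gap_mem g (by omega) (by omega))
        subst this
        exact .inl ⟨rfl, rfl⟩
      · have : s + 1 = l := by
          by_contra hcon
          exact hw.2 (N.gap_mem g (by omega) (by omega))
        subst this
        exact .inr ⟨rfl, rfl⟩
    by_cases hwx : w = x₁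
    · have hvS := (Finset.mem_sdiff.1 hvcore.1).1
      have := N.three_le
      rcases N.nb_left v hvS (hwx ▸ hadj.symm) with h | h
      · exact key 1 (by omega) h (.inl ⟨by rw [hwx, Nat.sub_self, N.zero], by omega⟩)
      · exact key (m - 1) (by omega) h
          (.inr ⟨by rw [hwx, Nat.sub_add_cancel (by omega), N.last], by omega⟩)
    · have haw : G.Att D w := by
        by_contra haw
        exact hw.2 (mem_comp_of_adj hv
          (mem_core.2 ⟨Finset.mem_sdiff.2 ⟨hw.1, hwD⟩, hwx, haw⟩) hadj)
      obtain ⟨t, h0, ht, rfl⟩ := N.exists_index (Finset.mem_sdiff.2 ⟨hw.1, hwD⟩) hwx haw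
      have hvS := Finset.mem_sdiff.1 hvcore.1
      rcases N.eq_of_adj_att h0 ht haw hvS.1 hvS.2 hadj.symm with h | h
      · exact key (t - 1) (by omega) h (.inr ⟨by rw [Nat.sub_add_cancel h0], by omega⟩)
      · exact key (t + 1) (by omega) h (.inl ⟨rfl, by omega⟩)
  · rintro (⟨rfl, rfl⟩ | ⟨rfl, rfl⟩)
    · exact (N.adj i (by omega)).symm
    · have := N.adj (l - 1) (by omega)
      rwa [Nat.sub_add_cancel (by omega)] at this

theorem gap_ends_ne : c i ≠ c l := by
  have hgl := g.lt
  have hgm := g.le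
  intro h
  rcases g.ne with hi | hl
  · have := N.eq_of_eq (by omega) (by omega) hi (by omega) h
    omega
  · have := N.eq_of_eq (by omega) (by omega) (by omega) hl h.symm
    omega

theorem gap_subset : G.comp (G.core S D x₁) (c (i + 1)) ⊆ S \ D :=
  comp_subset.trans (Finset.filter_subset _ _)

theorem gap_card : ∀ v ∈ G.comp (G.core S D x₁) (c (i + 1)),
    (G.nb (S \ G.comp (G.core S D x₁) (c (i + 1))) v).card + port x₁ x₂ v =
      port (c (i + 1)) (c (l - 1)) v := by
  have hgl := g.lt
  have hgm := g.le
  refine exits_card (p := c i) (q := c l) ?_ ?_ (N.gap_ends_ne g) ?_ ?_ (N.gap_exits g)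
  · exact Finset.mem_sdiff.2 ⟨(Finset.mem_sdiff.1 (N.mem i (by omega))).1,
      N.gap_notMem g (by omega) (.inl le_rfl)⟩
  · exact Finset.mem_sdiff.2 ⟨(Finset.mem_sdiff.1 (N.mem l (by omega))).1,
      N.gap_notMem g (by omega) (.inr le_rfl)⟩
  · intro h
    have := mem_core.1 (comp_subset h)
    exact this.2.1 rfl
  · intro h
    exact (Finset.mem_sdiff.1 (N.gap_subset g h)).2 N.right_mem

theorem gap_region :
    G.Region (G.comp (G.core S D x₁) (c (i + 1))) (c (i + 1)) (c (l - 1)) := by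
  have hgl := g.lt
  exact N.region.sub ((N.gap_subset g).trans Finset.sdiff_subset)
    (N.gap_mem g (by omega) (by omega)) (N.gap_mem g (by omega) (by omega)) (N.gap_card g)

theorem gap_wdeg : ∀ v ∈ G.comp (G.core S D x₁) (c (i + 1)),
    G.wdeg (G.comp (G.core S D x₁) (c (i + 1))) (c (i + 1)) (c (l - 1)) v = G.wdeg S x₁ x₂ v :=
  fun v hv ↦ wdeg_sub ((N.gap_subset g).trans Finset.sdiff_subset) (N.gap_card g v hv)

theorem gap_ssubset : G.comp (G.core S D x₁) (c (i + 1)) ⊂ S :=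
  Finset.ssubset_iff_subset_ne.2 ⟨(N.gap_subset g).trans Finset.sdiff_subset, fun h ↦
    (Finset.mem_sdiff.1 (N.gap_subset g (h.symm ▸ N.region.right_mem))).2 N.right_mem⟩

/-- The paths run from `x₁` along the cycle to the gap, through it to an attachment, and on through
`D` to `x₂`. If `l = m`, the gap is traversed backwards, since its far end is then `x₁` itself. -/
theorem gap_closeLengths
    (h : G.CloseLengths (G.comp (G.core S D x₁) (c (i + 1))) (c (i + 1)) (c (l - 1))) :
    G.CloseLengths S x₁ x₂ := by
  have hgl := g.lt
  have hgm := g.le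
  have hRD : ∀ s ≤ m, (s ≤ i ∨ l ≤ s) →
      Disjoint (G.comp (G.core S D x₁) (c (i + 1))) ({c s} ∪ D) := by
    intro s hs hsi
    rw [Finset.disjoint_union_right, Finset.disjoint_singleton_right]
    exact ⟨N.gap_notMem g hs hsi,
      Finset.disjoint_of_subset_left (N.gap_subset g) Finset.sdiff_disjoint⟩
  have hRS := (N.gap_subset g).trans (Finset.sdiff_subset)
  have hQS : ∀ s ≤ m, {c s} ∪ D ⊆ S := fun s hs ↦ Finset.union_subset
    (by simpa using (Finset.mem_sdiff.1 (N.mem s hs)).1) N.subset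
  by_cases hl : l = m
  · have hi : 0 < i := g.ne.resolve_right (by omega)
    obtain ⟨n, hn⟩ := N.hasPath_att (by omega) (g.left.resolve_left (by omega))
    have hadj := N.adj (l - 1) (by omega)
    rw [Nat.sub_add_cancel (by omega), hl, N.last, ← hl] at hadj
    refine h.reverse.sandwich (HasPath.single (Finset.mem_singleton_self x₁)) hn
      hadj.symm (N.adj i (by omega)).symm ?_ (hRD i (by omega) (.inl le_rfl)) ?_ ?_ hRS
      (hQS i (by omega))
    · have := N.gap_notMem g (t := 0) (by omega) (by omega)
      rw [N.zero] at this
      exact Finset.disjoint_singleton_left.2 this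
    · rw [Finset.disjoint_singleton_left, Finset.mem_union, Finset.mem_singleton, not_or]
      exact ⟨(N.ne_left hi (by omega)).symm, N.left_notMem⟩
    · simpa using N.region.left_mem
  · obtain ⟨n, hn⟩ := N.hasPath_att (by omega) (g.right.resolve_left hl)
    have hadj := N.adj (l - 1) (by omega)
    rw [Nat.sub_add_cancel (by omega)] at hadj
    refine h.sandwich (N.hasPath_prefix (t := i) (by omega)) hn (N.adj i (by omega)) hadj ?_
      (hRD l hgm (.inr le_rfl)) ?_ ?_ hRS (hQS l hgm)
    · rw [Finset.disjoint_left]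
      intro v hv
      obtain ⟨k, hk, rfl⟩ := Finset.mem_image.1 hv
      rw [Finset.mem_Icc] at hk
      exact N.gap_notMem g (by omega) (by omega)
    · rw [Finset.disjoint_left]
      intro v hv
      obtain ⟨k, hk, rfl⟩ := Finset.mem_image.1 hv
      rw [Finset.mem_Icc] at hk
      rw [Finset.mem_union, Finset.mem_singleton, not_or]
      refine ⟨fun h ↦ ?_, (Finset.mem_sdiff.1 (N.mem k (by omega))).2⟩
      have := N.eq_of_eq hgm (by omega) (by omega) (by omega) h.symm
      omega
    · exact (N.image_subset (by omega)).trans Finset.sdiff_subset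

end Necklace

end NecklaceLemmas

/-! ### Regions with at most one vertex of degree two -/

section OneException

variable {V : Type*} [DecidableEq V] {G : SimpleGraph V} [DecidableRel G.Adj]
variable {S R D : Finset V} {x₁ x₂ : V} {m : ℕ} {c : ℕ → V}

theorem Necklace.exists_gap (N : G.Necklace S x₁ x₂ D m c) {j : ℕ} (h0 : 0 < j) (hj : j < m)
    (ha : ¬ G.Att D (c j)) : ∃ i l, G.Gap D m c i l ∧ i < j ∧ j < l := by
  classical
  have hex : ∃ l, j < l ∧ (l = m ∨ G.Att D (c l)) := ⟨m, hj, .inl rfl⟩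
  obtain ⟨hl, hl'⟩ := Nat.find_spec hex
  have hlm : Nat.find hex ≤ m := Nat.find_min' hex ⟨hj, .inl rfl⟩
  have hlmin : ∀ t, j < t → t < Nat.find hex → ¬ G.Att D (c t) := fun t h1 h2 h3 ↦
    Nat.find_min hex h2 ⟨h1, .inr h3⟩
  have hi := Nat.findGreatest_spec (P := fun i ↦ i = 0 ∨ G.Att D (c i)) (Nat.zero_le j) (.inl rfl)
  have hij := Nat.findGreatest_le (P := fun i ↦ i = 0 ∨ G.Att D (c i)) j
  have hgr : ∀ t, Nat.findGreatest (fun i ↦ i = 0 ∨ G.Att D (c i)) j < t → t ≤ j →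
      ¬ G.Att D (c t) := fun t h1 h2 h3 ↦
    Nat.findGreatest_is_greatest (P := fun i ↦ i = 0 ∨ G.Att D (c i)) h1 h2 (.inr h3)
  generalize Nat.find hex = l at *
  generalize Nat.findGreatest (fun i ↦ i = 0 ∨ G.Att D (c i)) j = i at *
  have hij' : i < j := by
    refine lt_of_le_of_ne hij ?_
    rintro rfl
    exact ha (hi.resolve_left (by omega))
  have hbet : ∀ t, i < t → t < l → ¬ G.Att D (c t) := fun t h1 h2 ↦ by
    rcases le_or_gt t j with h | h
    · exact hgr t h1 h
    · exact hlmin t h h2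
  refine ⟨i, l, ⟨by omega, hlm, hi, hl', ?_, hbet⟩, hij', hl⟩
  -- Some attachment exists, so the gap cannot be the whole cycle.
  by_contra hcon
  obtain ⟨t, ht0, htm, hatt⟩ := N.exists_att
  exact hbet t (by omega) (by omega) hatt

theorem Region.wdeg_singleton {r r' z : V} (h : G.Region {z} r r') :
    G.wdeg {z} r r' z = 2 := by
  have h1 := Finset.mem_singleton.1 h.left_mem
  have h2 := Finset.mem_singleton.1 h.right_mem
  have : G.nb {z} z = ∅ := by
    ext w
    simp only [mem_nb, Finset.mem_singleton, Finset.notMem_empty, iff_false]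
    rintro ⟨rfl, h⟩
    exact G.loopless.irrefl _ h
  subst h1 h2
  simp [wdeg, this, port]

/-- The region has at most one vertex of degree two in `T`. -/
def AtMostOne (G : SimpleGraph V) [DecidableRel G.Adj] (S : Finset V) (x₁ x₂ : V)
    (T : Finset V) : Prop :=
  ∀ u ∈ T, ∀ v ∈ T, G.wdeg S x₁ x₂ u = 2 → G.wdeg S x₁ x₂ v = 2 → u = v

/-- A position whose two arcs to `x₁` differ by one or two is either an attachment, which suffices,
or inside a gap. That gap has close lengths or is a single vertex of degree two. There are always
two such positions, and they cannot both be exceptional. -/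
theorem Necklace.closeLengths (N : G.Necklace S x₁ x₂ D m c)
    (IH : ∀ R ⊂ S, ∀ r r', G.Region R r r' → G.AtMostOne R r r' R →
      G.CloseLengths R r r' ∨ ∃ z, R = {z})
    (hex : G.AtMostOne S x₁ x₂ (S \ D)) : G.CloseLengths S x₁ x₂ := by
  by_contra hcon
  have key : ∀ j, 0 < j → j < m →
      (m = 2 * j + 1 ∨ m = 2 * j + 2 ∨ 2 * j = m + 1 ∨ 2 * j = m + 2) →
      G.wdeg S x₁ x₂ (c j) = 2 := by
    intro j h0 hj hc
    have ha : ¬ G.Att D (c j) := fun ha ↦ hcon (N.closeLengths_of_att h0 hj ha hc)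
    obtain ⟨i, l, g, hi, hl⟩ := N.exists_gap h0 hj ha
    have hmem := N.gap_mem g hi hl
    have hreg := N.gap_region g
    rcases IH _ (N.gap_ssubset g) _ _ hreg (fun u hu v hv h1 h2 ↦
      hex u (N.gap_subset g hu) v (N.gap_subset g hv) (N.gap_wdeg g u hu ▸ h1)
        (N.gap_wdeg g v hv ▸ h2)) with h | ⟨z, hz⟩
    · exact absurd (N.gap_closeLengths g h) hcon
    · have hw := N.gap_wdeg g _ hmem
      rw [hz] at hmem hreg hw
      rw [Finset.mem_singleton] at hmem
      rw [← hw, hmem]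
      exact hreg.wdeg_singleton
  have hm := N.three_le
  have fin : ∀ j k, 0 < j → j < k → k < m →
      (m = 2 * j + 1 ∨ m = 2 * j + 2 ∨ 2 * j = m + 1 ∨ 2 * j = m + 2) →
      (m = 2 * k + 1 ∨ m = 2 * k + 2 ∨ 2 * k = m + 1 ∨ 2 * k = m + 2) → False := by
    intro j k h0 hjk hk hj hk'
    have := N.eq_of_eq (by omega) (by omega) h0 (by omega) (hex _ (N.mem j (by omega)) _
      (N.mem k (by omega)) (key j h0 (by omega) hj) (key k (by omega) hk hk'))
    omega
  -- For `m = 2t` the positions are `t - 1` and `t + 1`; for `m = 2t + 1` they are `t` and `t + 1`.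
  rcases Nat.even_or_odd' m with ⟨t, ht | ht⟩
  · exact fin (t - 1) (t + 1) (by omega) (by omega) (by omega) (by omega) (by omega)
  · exact fin t (t + 1) (by omega) (by omega) (by omega) (by omega) (by omega)

theorem CloseLengths.cons {T : Finset V} {x a y : V} (h : G.CloseLengths T a y) (hxa : G.Adj x a)
    (hx : x ∉ T) (hxS : x ∈ S) (hTS : T ⊆ S) : G.CloseLengths S x y :=
  (h.reverse.append (HasPath.single (Finset.mem_singleton_self x)) hxa.symm (by simpa using hx) hTS
    (by simpa using hxS)).reverse

theorem CloseLengths.cons_concat {T : Finset V} {x a b y : V} (h : G.CloseLengths T a b)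
    (hxa : G.Adj x a) (hyb : G.Adj y b) (hx : x ∉ T) (hy : y ∉ T) (hxy : x ≠ y) (hxS : x ∈ S)
    (hyS : y ∈ S) (hTS : T ⊆ S) : G.CloseLengths S x y :=
  h.sandwich (HasPath.single (Finset.mem_singleton_self x))
    (HasPath.single (Finset.mem_singleton_self y)) hxa hyb.symm (by simpa using hx)
    (by simpa using hy) (by simpa using hxy) (by simpa using hxS) hTS (by simpa using hyS)

theorem AtMostOne.mono {T T' : Finset V} (h : G.AtMostOne S x₁ x₂ T) (hT : T' ⊆ T) :
    G.AtMostOne S x₁ x₂ T' := fun u hu v hv ↦ h u (hT hu) v (hT hv)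

theorem AtMostOne.congr {S' : Finset V} {y₁ y₂ : V} {T : Finset V}
    (h : G.AtMostOne S x₁ x₂ T) (hT : ∀ v ∈ T, G.wdeg S' y₁ y₂ v = G.wdeg S x₁ x₂ v) :
    G.AtMostOne S' y₁ y₂ T := fun u hu v hv h1 h2 ↦ h u hu v hv (hT u hu ▸ h1) (hT v hv ▸ h2)

/-- A region with at most one vertex of degree two has two paths between its ends whose lengths
differ by one or two, unless it is a single vertex. -/
theorem Region.closeLengths_or_singleton (S : Finset V) : ∀ x₁ x₂, G.Region S x₁ x₂ →
    G.AtMostOne S x₁ x₂ S → G.CloseLengths S x₁ x₂ ∨ ∃ z, S = {z} := by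
  induction S using Finset.strongInduction with
  | H S IH =>
  have hleft : ∀ x₁ x₂, G.Region S x₁ x₂ → G.AtMostOne S x₁ x₂ S → x₁ ≠ x₂ →
      G.wdeg S x₁ x₂ x₁ = 2 → G.CloseLengths S x₁ x₂ := by
    intro x₁ x₂ hS hex hne hw
    obtain ⟨a, ha, hadj, hreg, hwd⟩ := hS.delete_left hne hw
    rcases IH (S \ {x₁}) (Finset.sdiff_ssubset (by simpa using hS.left_mem) (by simp)) _ _ hreg
      ((hex.mono Finset.sdiff_subset).congr hwd) with h | ⟨z, hz⟩
    · exact h.cons hadj (by simp) hS.left_mem Finset.sdiff_subset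
    -- A single remaining vertex would be a second vertex of degree two, next to `x₁`.
    · have hzm : z ∈ S \ {x₁} := by simp [hz]
      have hwz := hwd z hzm
      rw [hz] at hreg
      rw [hz, hreg.wdeg_singleton] at hwz
      have := hex z (Finset.sdiff_subset hzm) x₁ hS.left_mem hwz.symm hw
      simp [this] at hzm
  intro x₁ x₂ hS hex
  by_cases hne : x₁ = x₂
  · subst hne
    exact .inr ⟨_, hS.eq_singleton⟩
  left
  by_cases hw₁ : G.wdeg S x₁ x₂ x₁ = 2
  · exact hleft _ _ hS hex hne hw₁
  by_cases hw₂ : G.wdeg S x₁ x₂ x₂ = 2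
  · rw [wdeg_comm] at hw₂
    exact (hleft _ _ hS.symm (hex.congr fun v _ ↦ wdeg_comm v) (Ne.symm hne) hw₂).reverse
  have hssub : S \ {x₁, x₂} ⊂ S := Finset.sdiff_ssubset
    (by simp [Finset.insert_subset_iff, hS.left_mem, hS.right_mem]) (by simp)
  by_cases hadj : G.Adj x₁ x₂
  · obtain ⟨a, ha, b, hb, hxa, hxb, hreg, hwd⟩ := hS.delete_both hadj hw₁ hw₂
    rcases IH (S \ {x₁, x₂}) hssub _ _ hreg ((hex.mono hssub.1).congr hwd) with h | ⟨z, hz⟩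
    · exact h.cons_concat hxa hxb (by simp) (by simp) hne hS.left_mem hS.right_mem hssub.1
    -- Here `S` is a triangle, with end-to-end paths of lengths 1 and 2.
    · rw [hz, Finset.mem_singleton] at ha hb
      subst ha hb
      have hbS : b ∈ S := hssub.1 (by simp [hz])
      have e₁ := HasPath.single (G := G) (Finset.mem_singleton_self x₁)
      have e₂ := HasPath.single (G := G) (Finset.mem_singleton_self x₂)
      have e₃ := HasPath.single (G := G) (Finset.mem_singleton_self b)
      have p₁ := e₁.append (X := S) e₂ hadj (by simpa using hne)
        (by simpa using hS.left_mem) (by simpa using hS.right_mem)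
      have p₂ := (e₁.append (X := {x₁, b}) e₃ hxa (by simpa using hxa.ne) (by simp)
        (by simp)).append (X := S) e₂ hxb.symm (by simp [Ne.symm hne, hxb.ne])
        (by simp [Finset.insert_subset_iff, hS.left_mem, hbS]) (by simpa using hS.right_mem)
      exact ⟨_, _, p₁, p₂, by omega⟩
  obtain ⟨a, b, hab, hnb⟩ := hS.exists_nb_eq_pair hne hw₁
  by_cases hr : G.Reach (S \ {x₁, x₂}) a b
  · have heq : (S \ {x₂}) \ {x₁} = S \ {x₁, x₂} := by
      ext
      simp only [Finset.mem_sdiff, Finset.mem_singleton, Finset.mem_insert]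
      tauto
    obtain ⟨D, m, c, -, N⟩ := hS.exists_necklace hab hnb (D₀ := {x₂}) (by simpa using hS.right_mem)
      (by simpa using hne) (by simp) (fun v hv ↦ by
        rw [Finset.mem_singleton] at hv
        subst hv
        exact .refl (by simp)) (heq ▸ hr)
    exact N.closeLengths IH (hex.mono Finset.sdiff_subset)
  · obtain ⟨A, B, a', b', hdis, hun, hxa, hxb, hya, hyb, rA, rB, wA, wB⟩ :=
      hS.split hne hadj hnb hw₂ hr
    have hA : A ⊆ S \ {x₁, x₂} := hun ▸ Finset.subset_union_left
    have hB : B ⊆ S \ {x₁, x₂} := hun ▸ Finset.subset_union_right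
    rcases IH A (hA.trans_ssubset hssub) _ _ rA
      ((hex.mono (hA.trans hssub.1)).congr wA) with h | ⟨z, rfl⟩
    · exact h.cons_concat hxa hya (fun h ↦ by simpa using hA h) (fun h ↦ by simpa using hA h) hne
        hS.left_mem hS.right_mem (hA.trans hssub.1)
    rcases IH B (hB.trans_ssubset hssub) _ _ rB
      ((hex.mono (hB.trans hssub.1)).congr wB) with h | ⟨z', rfl⟩
    · exact h.cons_concat hxb hyb (fun h ↦ by simpa using hB h) (fun h ↦ by simpa using hB h) hne
        hS.left_mem hS.right_mem (hB.trans hssub.1)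
    -- Two single-vertex sides would give two vertices of degree two.
    have := hex z (hssub.1 (hA (by simp))) z' (hssub.1 (hB (by simp)))
      ((wA z (by simp)).symm.trans rA.wdeg_singleton)
      ((wB z' (by simp)).symm.trans rB.wdeg_singleton)
    simp [this] at hdis

/-- The same conclusion holds if all but one of the vertices of degree two, together with `x₂`, lie
in a connected set that avoids some cycle through `x₁`. -/
theorem Region.closeLengths_of_connected (hS : G.Region S x₁ x₂) {a b : V} (hab : a ≠ b)
    (hnb : G.nb S x₁ = {a, b}) (hD : D ⊆ S) (hx₁ : x₁ ∉ D) (hx₂ : x₂ ∈ D)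
    (hconn : ∀ v ∈ D, G.Reach D v x₂) (hr : G.Reach ((S \ D) \ {x₁}) a b)
    (hex : G.AtMostOne S x₁ x₂ (S \ D)) : G.CloseLengths S x₁ x₂ := by
  obtain ⟨D', m, c, hDD', N⟩ := hS.exists_necklace hab hnb hD hx₁ hx₂ hconn hr
  exact N.closeLengths (fun R _ ↦ closeLengths_or_singleton R)
    (hex.mono (Finset.sdiff_subset_sdiff subset_rfl hDD'))

end OneException

/-! ### Ladders and how to glue them -/

section Ladders

variable {V : Type*} [DecidableEq V] {G : SimpleGraph V} [DecidableRel G.Adj]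
variable {S R H D : Finset V} {x₁ x₂ y z : V} {m : ℕ} {c : ℕ → V} {n n' : ℕ}

/-- Disjoint paths in `S` from `x₁` to `y` and from `x₂` to `z` with at least `n` edges between
them. -/
def Linkage (G : SimpleGraph V) [DecidableRel G.Adj] (S : Finset V) (x₁ x₂ y z : V) (n : ℕ) :
    Prop :=
  ∃ A B : Finset V, A ⊆ S ∧ B ⊆ S ∧ Disjoint A B ∧ (∃ k, G.PathOn A x₁ y k) ∧
    (∃ k, G.PathOn B x₂ z k) ∧ n ≤ (G.interedges A B).card

/-- Disjoint paths in `S` from `{x₁, x₂}` to `{y, z}` with at least `n` edges between them. -/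
def Ladder (G : SimpleGraph V) [DecidableRel G.Adj] (S : Finset V) (x₁ x₂ y z : V) (n : ℕ) :
    Prop :=
  G.Linkage S x₁ x₂ y z n ∨ G.Linkage S x₁ x₂ z y n

theorem Linkage.swap (h : G.Linkage S x₁ x₂ y z n) : G.Linkage S x₂ x₁ z y n := by
  obtain ⟨A, B, hA, hB, hAB, hpA, hpB, hn⟩ := h
  exact ⟨B, A, hB, hA, hAB.symm, hpB, hpA,
    hn.trans_eq (have := G.symm; Rel.card_interedges_comm A B)⟩

theorem Linkage.of_le (h : G.Linkage S x₁ x₂ y z n) (hn : n' ≤ n) :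
    G.Linkage S x₁ x₂ y z n' := by
  obtain ⟨A, B, hA, hB, hAB, hpA, hpB, hn'⟩ := h
  exact ⟨A, B, hA, hB, hAB, hpA, hpB, hn.trans hn'⟩

theorem Linkage.append {p q r r' : V} (h₁ : G.Linkage H x₁ x₂ p q n)
    (h₂ : G.Linkage R r r' y z n') (hpr : G.Adj p r) (hqr : G.Adj q r') (hHR : Disjoint H R)
    (hH : H ⊆ S) (hR : R ⊆ S) : G.Linkage S x₁ x₂ y z (n + n') := by
  obtain ⟨A, B, hA, hB, hAB, ⟨k, hpA⟩, ⟨l, hpB⟩, hn⟩ := h₁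
  obtain ⟨A', B', hA', hB', hAB', ⟨k', hpA'⟩, ⟨l', hpB'⟩, hn'⟩ := h₂
  refine ⟨A ∪ A', B ∪ B', Finset.union_subset (hA.trans hH) (hA'.trans hR),
    Finset.union_subset (hB.trans hH) (hB'.trans hR), ?_,
    ⟨_, hpA.append hpA' hpr (hHR.mono hA hA')⟩, ⟨_, hpB.append hpB' hqr (hHR.mono hB hB')⟩, ?_⟩
  · rw [Finset.disjoint_union_left, Finset.disjoint_union_right, Finset.disjoint_union_right]
    exact ⟨⟨hAB, hHR.mono hA hB'⟩, hHR.symm.mono hA' hB, hAB'⟩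
  · have hdis : Disjoint (G.interedges A B) (G.interedges A' B') := by
      rw [Finset.disjoint_left]
      rintro ⟨u, v⟩ h h'
      rw [mem_interedges_iff] at h h'
      exact Finset.disjoint_left.1 hHR (hA h.1) (hA' h'.1)
    refine (Nat.add_le_add hn hn').trans ?_
    rw [← Finset.card_union_of_disjoint hdis]
    refine Finset.card_le_card (Finset.union_subset ?_ ?_)
    · exact interedges_mono G Finset.subset_union_left Finset.subset_union_left
    · exact interedges_mono G Finset.subset_union_right Finset.subset_union_right

theorem Linkage.of_adj (h : G.Adj x₁ x₂) (h₁ : x₁ ∈ S) (h₂ : x₂ ∈ S) :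
    G.Linkage S x₁ x₂ x₁ x₂ 1 :=
  ⟨{x₁}, {x₂}, by simpa using h₁, by simpa using h₂, by simpa using h.ne, ⟨_, .single x₁⟩,
    ⟨_, .single x₂⟩, Finset.card_pos.2 ⟨(x₁, x₂), by simp [mem_interedges_iff, h]⟩⟩

/-- Opposite edges of the 4-cycle serve as the paths, the other two as rungs. -/
theorem Linkage.of_square {w w' : V} (h₁ : G.Adj x₁ w) (h₂ : G.Adj x₂ w') (h₃ : G.Adj x₁ w')
    (h₄ : G.Adj x₂ w) (hx : x₁ ≠ x₂) (hw : w ≠ w') (hS : {x₁, x₂, w, w'} ⊆ S) :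
    G.Linkage S x₁ x₂ w w' 2 := by
  simp only [Finset.insert_subset_iff, Finset.singleton_subset_iff] at hS
  refine ⟨{x₁} ∪ {w}, {x₂} ∪ {w'}, ?_, ?_, ?_,
    ⟨_, (PathOn.single x₁).append (.single w) h₁ (by simpa using h₁.ne)⟩,
    ⟨_, (PathOn.single x₂).append (.single w') h₂ (by simpa using h₂.ne)⟩, ?_⟩
  · simp [Finset.insert_subset_iff, hS]
  · simp [Finset.insert_subset_iff, hS]
  · simp [h₄.ne, h₃.ne', hx.symm, hw.symm]
  · rw [← Finset.card_pair (a := (x₁, w')) (b := (w, x₂)) (by simp [h₁.ne])]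
    refine Finset.card_le_card ?_
    simp [Finset.insert_subset_iff, mem_interedges_iff, h₃, h₄.symm]

theorem Ladder.comm (h : G.Ladder S x₁ x₂ y z n) : G.Ladder S x₁ x₂ z y n := Or.symm h

theorem Ladder.swap (h : G.Ladder S x₁ x₂ y z n) : G.Ladder S x₂ x₁ y z n :=
  h.elim (fun h ↦ .inr h.swap) (fun h ↦ .inl h.swap)

theorem Ladder.of_le (h : G.Ladder S x₁ x₂ y z n) (hn : n' ≤ n) : G.Ladder S x₁ x₂ y z n' :=
  h.imp (fun h ↦ h.of_le hn) (fun h ↦ h.of_le hn)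

/-- Glueing works because a ladder does not prescribe how its ends are paired. -/
theorem Ladder.append {p q r r' : V} (h₁ : G.Ladder H x₁ x₂ p q n)
    (h₂ : G.Ladder R r r' y z n') (hpr : G.Adj p r) (hqr : G.Adj q r') (hHR : Disjoint H R)
    (hH : H ⊆ S) (hR : R ⊆ S) : G.Ladder S x₁ x₂ y z (n + n') := by
  rcases h₁ with h₁ | h₁
  · exact h₂.imp (fun h₂ ↦ h₁.append h₂ hpr hqr hHR hH hR)
      (fun h₂ ↦ h₁.append h₂ hpr hqr hHR hH hR)
  · exact h₂.symm.imp (fun h₂ ↦ h₁.append h₂.swap hqr hpr hHR hH hR)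
      (fun h₂ ↦ h₁.append h₂.swap hqr hpr hHR hH hR)

end Ladders

/-! ### The complement of a gap as a region -/

section Complement

variable {V : Type*} [DecidableEq V] {G : SimpleGraph V} [DecidableRel G.Adj]
variable {S R H D : Finset V} {x₁ x₂ : V} {m : ℕ} {c : ℕ → V} {i l : ℕ}

theorem one_le_card_nb {T : Finset V} {v w : V} (hw : w ∈ T) (h : G.Adj v w) :
    1 ≤ (G.nb T v).card :=
  Finset.card_pos.2 ⟨w, mem_nb.2 ⟨hw, h⟩⟩

/-- The cut condition for a set containing a vertex `p` that has walks to `x₁` and `x₂` with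
disjoint interiors. -/
theorem two_le_cut_of_reach {p : V} {W : Finset V} (hD : D ⊆ H) (hx₂ : x₂ ∈ D)
    (hp : p ∈ W) (hpx : p ≠ x₁) (h₁ : G.Reach (H \ D) p x₁)
    (h₂ : G.Reach ({p} ∪ D) p x₂) :
    2 ≤ ∑ v ∈ W, ((G.nb (H \ W) v).card + port x₁ x₂ v) := by
  have hx₁ := (Finset.mem_sdiff.1 h₁.right_mem).2
  have hx : x₁ ≠ x₂ := fun h ↦ hx₁ (h ▸ hx₂)
  have second : ∀ w, w ∉ W → w ∈ ({p} ∪ D : Finset V) → w ∈ D := fun w hw hwD ↦ by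
    rw [Finset.mem_union, Finset.mem_singleton] at hwD
    exact hwD.resolve_left fun h ↦ hw (h ▸ hp)
  by_cases hW₁ : x₁ ∈ W
  · have e₁ : 1 ≤ (G.nb (H \ W) x₁).card + port x₁ x₂ x₁ := by simp [port]; omega
    by_cases hW₂ : x₂ ∈ W
    · exact two_le_cut_of hW₁ hW₂ e₁ (by simp [port]; omega) fun h ↦ absurd h hx
    · obtain ⟨v, hv, w, hw, hvW, hwW, hadj⟩ := h₂.exists_adj hp hW₂
      have hwD := second w hwW hw
      refine two_le_cut_of hW₁ hvW e₁
        ((one_le_card_nb (Finset.mem_sdiff.2 ⟨hD hwD, hwW⟩) hadj).trans (Nat.le_add_right _ _)) ?_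
      rintro rfl
      rw [Finset.mem_union, Finset.mem_singleton] at hv
      exact absurd hv (not_or.2 ⟨hpx.symm, hx₁⟩)
  · obtain ⟨u, hu, t, ht, huW, htW, huadj⟩ := h₁.exists_adj hp hW₁
    rw [Finset.mem_sdiff] at hu ht
    have e₁ : 1 ≤ (G.nb (H \ W) u).card + port x₁ x₂ u :=
      (one_le_card_nb (Finset.mem_sdiff.2 ⟨ht.1, htW⟩) huadj).trans (Nat.le_add_right _ _)
    by_cases hW₂ : x₂ ∈ W
    · exact two_le_cut_of huW hW₂ e₁ (by simp [port]; omega) fun h ↦ absurd hx₂ (h ▸ hu.2)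
    · obtain ⟨v, hv, w, hw, hvW, hwW, hadj⟩ := h₂.exists_adj hp hW₂
      have hwD := second w hwW hw
      refine two_le_cut_of huW hvW e₁
        ((one_le_card_nb (Finset.mem_sdiff.2 ⟨hD hwD, hwW⟩) hadj).trans (Nat.le_add_right _ _)) ?_
      -- Both exits may start at the same vertex, but `t` lies outside `D` and `w` inside, so they
      -- are different edges.
      rintro rfl
      refine le_trans ?_ (Nat.le_add_right _ _)
      rw [← Finset.card_pair (a := t) (b := w) fun h ↦ ht.2 (h ▸ hwD)]
      refine Finset.card_le_card ?_
      simp [Finset.insert_subset_iff, ht.1, htW, huadj, hD hwD, hwW, hadj]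

namespace Necklace

variable (N : G.Necklace S x₁ x₂ D m c) (g : G.Gap D m c i l)
include N g

theorem gap_subset_compl : D ⊆ S \ G.comp (G.core S D x₁) (c (i + 1)) := fun _ hd ↦
  Finset.mem_sdiff.2 ⟨N.subset hd, fun h ↦ (Finset.mem_sdiff.1 (N.gap_subset g h)).2 hd⟩

theorem mem_gap_compl {t : ℕ} (ht : t ≤ m) (h : t ≤ i ∨ l ≤ t) :
    c t ∈ (S \ G.comp (G.core S D x₁) (c (i + 1))) \ D := by
  have := Finset.mem_sdiff.1 (N.mem t ht)
  exact Finset.mem_sdiff.2 ⟨Finset.mem_sdiff.2 ⟨this.1, N.gap_notMem g ht h⟩, this.2⟩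

/-- Both bounding attachments are cubic and lose exactly one neighbour to the gap; no other vertex
loses any. -/
theorem gap_compl_wdeg (hi : 0 < i) (hl : l < m) {v : V}
    (hv : v ∈ S \ G.comp (G.core S D x₁) (c (i + 1))) :
    G.wdeg (S \ G.comp (G.core S D x₁) (c (i + 1))) x₁ x₂ v =
      if v = c i ∨ v = c l then 2 else G.wdeg S x₁ x₂ v := by
  have hgl := g.lt
  have hne := N.gap_ends_ne g
  have hsum := card_nb_add (G := G) (Finset.disjoint_sdiff
    (s := G.comp (G.core S D x₁) (c (i + 1))) (t := S)) v
  rw [Finset.union_sdiff_of_subset ((N.gap_subset g).trans Finset.sdiff_subset)] at hsum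
  have hw : G.wdeg S x₁ x₂ v = (G.nb (G.comp (G.core S D x₁) (c (i + 1))) v).card +
      G.wdeg (S \ G.comp (G.core S D x₁) (c (i + 1))) x₁ x₂ v := by
    rw [wdeg, wdeg, hsum]
    omega
  have hone : ∀ p r, v = p → G.wdeg S x₁ x₂ p = 3 →
      (∀ w ∈ G.comp (G.core S D x₁) (c (i + 1)), G.Adj p w ↔ w = r) →
      r ∈ G.comp (G.core S D x₁) (c (i + 1)) →
      G.wdeg (S \ G.comp (G.core S D x₁) (c (i + 1))) x₁ x₂ v = 2 := by
    rintro p r rfl h3 hr hrm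
    have : G.nb (G.comp (G.core S D x₁) (c (i + 1))) v = {r} := by
      ext w
      rw [mem_nb, Finset.mem_singleton]
      exact ⟨fun h ↦ (hr w h.1).1 h.2, fun h ↦ ⟨h ▸ hrm, (hr w (h ▸ hrm)).2 h⟩⟩
    rw [this, Finset.card_singleton] at hw
    omega
  split_ifs with h
  · rcases h with rfl | rfl
    · obtain ⟨d, hd, hadj⟩ := g.left.resolve_left (by omega)
      refine hone _ (c (i + 1)) rfl (N.nb_att hi (by omega) hd hadj).2.2 (fun w hw ↦ ?_)
        (N.gap_mem g (by omega) (by omega))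
      rw [G.adj_comm, N.gap_exits g w hw _ hv]
      simp [hne]
    · obtain ⟨d, hd, hadj⟩ := g.right.resolve_left (by omega)
      refine hone _ (c (l - 1)) rfl (N.nb_att (by omega) hl hd hadj).2.2 (fun w hw ↦ ?_)
        (N.gap_mem g (by omega) (by omega))
      rw [G.adj_comm, N.gap_exits g w hw _ hv]
      simp [hne.symm]
  · have : G.nb (G.comp (G.core S D x₁) (c (i + 1))) v = ∅ := by
      rw [Finset.eq_empty_iff_forall_notMem]
      intro w hw
      rw [mem_nb, G.adj_comm] at hw
      have := (N.gap_exits g w hw.1 _ hv).1 hw.2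
      tauto
    rw [this, Finset.card_empty] at hw
    omega

/-- A set containing a bounding attachment has two exits, because the attachment reaches `x₁` along
the cycle and `x₂` through `D`. Any other set has no edges into the gap and keeps its exits from
`S`. -/
theorem gap_compl_region (hi : 0 < i) (hl : l < m) :
    G.Region (S \ G.comp (G.core S D x₁) (c (i + 1))) x₁ x₂ := by
  have hgl := g.lt
  have hHS : S \ G.comp (G.core S D x₁) (c (i + 1)) ⊆ S := Finset.sdiff_subset
  refine ⟨?_, N.gap_subset_compl g N.right_mem, fun v hv ↦ ?_, fun W hW hne ↦ ?_⟩
  · have := N.mem_gap_compl g (Nat.zero_le m) (.inl (Nat.zero_le i))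
    rw [N.zero] at this
    exact Finset.sdiff_subset this
  · rw [N.gap_compl_wdeg g hi hl hv]
    split_ifs
    · omega
    · exact N.region.wdeg_le v (hHS hv)
  have hend : ∀ t, G.Att D (c t) → 0 < t → t < m →
      G.Reach ((S \ G.comp (G.core S D x₁) (c (i + 1))) \ D) (c t) x₁ → c t ∈ W →
      2 ≤ ∑ v ∈ W, ((G.nb ((S \ G.comp (G.core S D x₁) (c (i + 1))) \ W) v).card +
        port x₁ x₂ v) := by
    rintro t ⟨d, hd, hadj⟩ h0 ht hr htW
    refine two_le_cut_of_reach (N.gap_subset_compl g) N.right_mem htW (N.ne_left h0 ht) hr ?_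
    exact (Reach.of_adj hadj.symm (by simp) (by simp [hd])).trans
      ((N.conn d hd).mono Finset.subset_union_right)
  by_cases hiW : c i ∈ W
  · refine hend i (g.left.resolve_left (by omega)) hi (by omega) (Reach.symm ?_) hiW
    have := Reach.of_seq (G := G) (c := c)
      (S := (S \ G.comp (G.core S D x₁) (c (i + 1))) \ D) (Nat.zero_le i)
      (fun k _ _ ↦ N.adj k (by omega)) fun k _ _ ↦ N.mem_gap_compl g (by omega) (by omega)
    rwa [N.zero] at this
  by_cases hlW : c l ∈ W
  · refine hend l (g.right.resolve_left (by omega)) (by omega) hl ?_ hlW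
    have := Reach.of_seq (G := G) (c := c)
      (S := (S \ G.comp (G.core S D x₁) (c (i + 1))) \ D) hl.le
      (fun k _ _ ↦ N.adj k (by omega)) fun k _ _ ↦ N.mem_gap_compl g (by omega) (by omega)
    rwa [N.last] at this
  refine (N.region.two_le_cut W (hW.trans hHS) hne).trans (Finset.sum_le_sum fun v hv ↦
    Nat.add_le_add_right (Finset.card_le_card fun w hw ↦ ?_) _)
  rw [mem_nb, Finset.mem_sdiff] at hw ⊢
  refine ⟨⟨Finset.mem_sdiff.2 ⟨hw.1.1, fun hwR ↦ ?_⟩, hw.1.2⟩, hw.2⟩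
  rcases (N.gap_exits g w hwR v (hW hv)).1 hw.2.symm with ⟨-, rfl⟩ | ⟨-, rfl⟩
  · exact hiW hv
  · exact hlW hv

end Necklace

end Complement

/-! ### Trapping both vertices of degree two in one gap -/

section Enclosing

variable {V : Type*} [DecidableEq V] {G : SimpleGraph V} [DecidableRel G.Adj]
variable {S R D : Finset V} {x₁ x₂ y z : V} {m : ℕ} {c : ℕ → V}

namespace Necklace

variable (N : G.Necklace S x₁ x₂ D m c)
include N

theorem reach_left {v : V} (hv : v ∈ S \ D) : G.Reach (S \ D) v x₁ := by
  have hx := N.mem 0 (Nat.zero_le _)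
  rw [N.zero] at hx
  by_cases hvx : v = x₁
  · rw [hvx]
    exact .refl hx
  have := N.three_le
  have h01 := N.adj 0 (by omega)
  rw [N.zero] at h01
  exact ((N.conn' v hv hvx).symm.mono Finset.sdiff_subset).trans
    (.of_adj h01.symm (N.mem 1 (by omega)) hx)

/-- A walk from `v` through `D` to `x₂` must enter `x₂` from `n₁` or `n₂`. -/
theorem reach_of_att {n₁ n₂ v : V} (hnb : G.nb S x₂ = {n₁, n₂}) (hv : v ∈ S) (ha : G.Att D v) :
    G.Reach ({v} ∪ (D \ {x₂})) v n₁ ∨ G.Reach ({v} ∪ (D \ {x₂})) v n₂ := by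
  have hB : ∀ w, w ∈ S ∧ G.Adj x₂ w ↔ w = n₁ ∨ w = n₂ := fun w ↦ by
    rw [← mem_nb, hnb, Finset.mem_insert, Finset.mem_singleton]
  obtain ⟨d, hd, hadj⟩ := ha
  by_cases hdx : d = x₂
  · subst hdx
    rcases (hB v).1 ⟨hv, hadj⟩ with rfl | rfl
    · exact .inl (.refl (by simp))
    · exact .inr (.refl (by simp))
  have key := (N.conn d hd).symm.induction
    (P := fun w ↦ w = x₂ ∨ G.Reach (D \ {x₂}) w n₁ ∨ G.Reach (D \ {x₂}) w n₂) (.inl rfl) (by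
      intro u hu w hw hPu huw
      by_cases hwx : w = x₂
      · exact .inl hwx
      right
      have hwD : w ∈ D \ {x₂} := by simp [hw, hwx]
      rcases hPu with rfl | hPu
      · rcases (hB w).1 ⟨N.subset hw, huw⟩ with rfl | rfl
        · exact .inl (.refl hwD)
        · exact .inr (.refl hwD)
      · exact hPu.imp (fun h ↦ (Reach.of_adj huw.symm hwD h.left_mem).trans h)
          (fun h ↦ (Reach.of_adj huw.symm hwD h.left_mem).trans h))
  have hvd : d ∈ D \ {x₂} → G.Reach ({v} ∪ (D \ {x₂})) v d := fun h ↦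
    .of_adj hadj.symm (by simp) (Finset.mem_union_right _ h)
  refine (key.resolve_left hdx).imp (fun h ↦ ?_) (fun h ↦ ?_)
  all_goals exact (hvd h.left_mem).trans (h.mono Finset.subset_union_right)

/-- If `n` is in `D`, its component in `D \ {x₂}` has an exit besides `nx₂`. As `n'` is not in this
component, the exit leads out of `D`, to an attachment. -/
theorem exists_att_reach {n n' : V} (hnb : G.nb S x₂ = {n, n'})
    (hr : ¬ G.Reach (D \ {x₂}) n n') :
    ∃ t, 0 < t ∧ t < m ∧ G.Att D (c t) ∧ G.Reach ({c t} ∪ (D \ {x₂})) (c t) n := by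
  have hB : ∀ w, w ∈ S ∧ G.Adj x₂ w ↔ w = n ∨ w = n' := fun w ↦ by
    rw [← mem_nb, hnb, Finset.mem_insert, Finset.mem_singleton]
  have hn := (hB n).2 (.inl rfl)
  by_cases hnD : n ∈ D
  · have hsub : G.comp (D \ {x₂}) n ⊆ D \ {x₂} := comp_subset
    have hsubD := hsub.trans Finset.sdiff_subset
    obtain ⟨v, hv, w, hw, hwC, hadj, hne⟩ := N.region.exists_exit (hsubD.trans N.subset)
      ⟨n, mem_comp.2 (.refl (by simp [hnD, hn.2.ne']))⟩ (fun h ↦ N.left_notMem (hsubD h))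
      (fun h ↦ by simpa using hsub h) n x₂
    have hwx : w ≠ x₂ := by
      rintro rfl
      rcases (hB v).1 ⟨N.subset (hsubD hv), hadj.symm⟩ with rfl | rfl
      · simp at hne
      · exact hr (mem_comp.1 hv)
    have hwD : w ∉ D := fun hwD ↦ hwC (mem_comp_of_adj hv (by simp [hwD, hwx]) hadj)
    have ha : G.Att D w := ⟨v, hsubD hv, hadj⟩
    obtain ⟨t, h0, ht, rfl⟩ := N.exists_index (Finset.mem_sdiff.2 ⟨hw, hwD⟩)
      (fun h ↦ N.not_att_left (h ▸ ha)) ha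
    exact ⟨t, h0, ht, ha, (Reach.of_adj hadj.symm (by simp)
      (Finset.mem_union_right _ (hsub hv))).trans
        ((mem_comp.1 hv).symm.mono Finset.subset_union_right)⟩
  · have ha : G.Att D n := ⟨x₂, N.right_mem, hn.2⟩
    obtain ⟨t, h0, ht, rfl⟩ := N.exists_index (Finset.mem_sdiff.2 ⟨hn.1, hnD⟩)
      (fun h ↦ N.not_att_left (h ▸ ha)) ha
    exact ⟨t, h0, ht, ha, .refl (by simp)⟩

/-- There is a cycle through `x₂` that consists of a path in `D` and a segment of the necklace
between two consecutive attachments, or even a single attachment. -/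
theorem exists_segment {n₁ n₂ : V} (hnb : G.nb S x₂ = {n₁, n₂})
    (hr : ¬ G.Reach (D \ {x₂}) n₁ n₂) :
    ∃ i l, 0 < i ∧ i ≤ l ∧ l < m ∧ G.Att D (c i) ∧ G.Att D (c l) ∧
      G.Reach ((Finset.Icc i l).image c ∪ (D \ {x₂})) n₁ n₂ ∧
      ∀ t, i < t → t < l → ¬ G.Att D (c t) := by
  classical
  let T : V → ℕ → Prop := fun n t ↦ G.Reach ({c t} ∪ (D \ {x₂})) (c t) n
  -- The pair is chosen with `l - i` minimal. An attachment strictly between reaches `n₁` or `n₂`,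
  -- and so could replace one of the two.
  let P : ℕ → ℕ → Prop := fun i l ↦ 0 < i ∧ i ≤ l ∧ l < m ∧ G.Att D (c i) ∧ G.Att D (c l) ∧
    (T n₁ i ∧ T n₂ l ∨ T n₂ i ∧ T n₁ l)
  have hex : ∃ e i l, P i l ∧ l - i = e := by
    obtain ⟨s, hs0, hsm, hsa, hs⟩ := N.exists_att_reach hnb hr
    obtain ⟨t, ht0, htm, hta, ht⟩ := N.exists_att_reach (Finset.pair_comm n₁ n₂ ▸ hnb)
      (fun h ↦ hr h.symm)
    rcases le_total s t with h | h
    · exact ⟨_, s, t, ⟨hs0, h, htm, hsa, hta, .inl ⟨hs, ht⟩⟩, rfl⟩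
    · exact ⟨_, t, s, ⟨ht0, h, hsm, hta, hsa, .inr ⟨ht, hs⟩⟩, rfl⟩
  obtain ⟨i, l, ⟨hi, hil, hl, hia, hla, hT⟩, he⟩ := Nat.find_spec hex
  have hmin : ∀ i' l', P i' l' → l - i ≤ l' - i' := fun i' l' h ↦
    he ▸ Nat.find_min' hex ⟨i', l', h, rfl⟩
  refine ⟨i, l, hi, hil, hl, hia, hla, ?_, fun t h1 h2 ha ↦ ?_⟩
  · have seg : G.Reach ((Finset.Icc i l).image c ∪ (D \ {x₂})) (c i) (c l) :=
      .of_seq hil (fun k _ _ ↦ N.adj k (by omega)) fun k h1 h2 ↦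
        Finset.mem_union_left _ (Finset.mem_image_of_mem c (Finset.mem_Icc.2 ⟨h1, h2⟩))
    have hsub : ∀ t, i ≤ t → t ≤ l → ({c t} ∪ (D \ {x₂}) : Finset V) ⊆
        (Finset.Icc i l).image c ∪ (D \ {x₂}) := fun t h1 h2 ↦
      Finset.union_subset_union_left (Finset.singleton_subset_iff.2
        (Finset.mem_image_of_mem c (Finset.mem_Icc.2 ⟨h1, h2⟩)))
    rcases hT with ⟨h1, h2⟩ | ⟨h1, h2⟩
    · exact ((h1.mono (hsub i le_rfl hil)).symm.trans seg).trans (h2.mono (hsub l hil le_rfl))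
    · exact ((h2.mono (hsub l hil le_rfl)).symm.trans seg.symm).trans
        (h1.mono (hsub i le_rfl hil))
  · have hright : ∀ _ : P t l, False := fun h ↦ by
      have := hmin _ _ h
      omega
    have hleft : ∀ _ : P i t, False := fun h ↦ by
      have := hmin _ _ h
      omega
    have hcS := (Finset.mem_sdiff.1 (N.mem t (by omega))).1
    rcases N.reach_of_att hnb hcS ha with h | h
    · rcases hT with hT | hT
      · exact hright ⟨by omega, by omega, hl, ha, hla, .inl ⟨h, hT.2⟩⟩
      · exact hleft ⟨hi, by omega, by omega, hia, ha, .inr ⟨hT.1, h⟩⟩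
    · rcases hT with hT | hT
      · exact hleft ⟨hi, by omega, by omega, hia, ha, .inl ⟨hT.1, h⟩⟩
      · exact hright ⟨by omega, by omega, hl, ha, hla, .inr ⟨h, hT.2⟩⟩

/-- Either there are two paths with close lengths, or the two vertices of degree two lie in a common
gap of the necklace that is not next to `x₁`. -/
theorem exists_enclosing_gap (h₂ : G.wdeg S x₁ x₂ x₂ ≠ 2) (h₁ : G.wdeg S x₁ x₂ x₁ ≠ 2)
    (hy : y ∈ S \ D) (hz : z ∈ S \ D)
    (hex : ∀ v ∈ S, G.wdeg S x₁ x₂ v = 2 ↔ v = y ∨ v = z) :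
    G.CloseLengths S x₁ x₂ ∨ ∃ i l, 0 < i ∧ l < m ∧ G.Gap D m c i l ∧
      y ∈ G.comp (G.core S D x₁) (c (i + 1)) ∧ z ∈ G.comp (G.core S D x₁) (c (i + 1)) := by
  rw [or_iff_not_imp_left]
  intro hcon
  have hne := N.ne_ends
  rw [wdeg_comm] at h₂
  obtain ⟨n₁, n₂, hn, hnb⟩ := N.region.symm.exists_nb_eq_pair hne.symm h₂
  -- The roles of `x₁` and `x₂` are exchanged: a connected set around `x₁` that avoids a cycle
  -- through `x₂` can contain neither `y` nor `z`, since at most one exception would remain outside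
  -- it.
  have key : ∀ D' ⊆ S, x₂ ∉ D' → x₁ ∈ D' → (∀ v ∈ D', G.Reach D' v x₁) →
      G.Reach ((S \ D') \ {x₂}) n₁ n₂ → y ∉ D' ∧ z ∉ D' := by
    intro D' hD' hx₂ hx₁ hconn hr
    by_contra hyz
    refine hcon (N.region.symm.closeLengths_of_connected hn hnb hD' hx₂ hx₁ hconn hr ?_).reverse
    intro u hu v hv hu2 hv2
    rw [Finset.mem_sdiff] at hu hv
    rw [wdeg_comm, hex u hu.1] at hu2
    rw [wdeg_comm, hex v hv.1] at hv2
    rcases hu2 with rfl | rfl <;> rcases hv2 with rfl | rfl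
    · rfl
    · exact absurd ⟨hu.2, hv.2⟩ hyz
    · exact absurd ⟨hv.2, hu.2⟩ hyz
    · rfl
  by_cases hr : G.Reach (D \ {x₂}) n₁ n₂
  · refine absurd hy (key (S \ D) Finset.sdiff_subset ?_ ?_ (fun v hv ↦ N.reach_left hv) ?_).1
    · simp [N.right_mem]
    · exact (N.reach_left hy).right_mem
    · rwa [Finset.sdiff_sdiff_eq_self N.subset]
  obtain ⟨i, l, hi, hil, hl, hia, hla, hreach, hbet⟩ := N.exists_segment hnb hr
  have hx₁ : x₁ ∈ (S \ D) \ (Finset.Icc i l).image c := by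
    refine Finset.mem_sdiff.2 ⟨(N.reach_left hy).right_mem, fun h ↦ ?_⟩
    obtain ⟨k, hk, hkx⟩ := Finset.mem_image.1 h
    rw [Finset.mem_Icc] at hk
    exact N.ne_left (by omega) (by omega) hkx
  have hsub : G.comp ((S \ D) \ (Finset.Icc i l).image c) x₁ ⊆ (S \ D) \ (Finset.Icc i l).image c :=
    comp_subset
  have hkey := key (G.comp ((S \ D) \ (Finset.Icc i l).image c) x₁)
    (hsub.trans (Finset.sdiff_subset.trans Finset.sdiff_subset))
    (fun h ↦ by
      have := Finset.mem_sdiff.1 (Finset.sdiff_subset (hsub h))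
      exact this.2 N.right_mem)
    (mem_comp.2 (.refl hx₁)) (fun v hv ↦ reach_comp_of_mem hv (mem_comp.2 (.refl hx₁))) (by
      refine hreach.mono fun v hv ↦ ?_
      have hv' : v ∉ (S \ D) \ (Finset.Icc i l).image c ∧ v ∈ S ∧ v ≠ x₂ := by
        rcases Finset.mem_union.1 hv with h | h
        · refine ⟨fun h' ↦ (Finset.mem_sdiff.1 h').2 h,
            (Finset.mem_sdiff.1 (N.image_subset hl.le h)).1, ?_⟩
          rintro rfl
          exact (Finset.mem_sdiff.1 (N.image_subset hl.le h)).2 N.right_mem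
        · rw [Finset.mem_sdiff, Finset.mem_singleton] at h
          exact ⟨fun h' ↦ (Finset.mem_sdiff.1 (Finset.sdiff_subset h')).2 h.1, N.subset h.1, h.2⟩
      exact Finset.mem_sdiff.2 ⟨Finset.mem_sdiff.2 ⟨hv'.2.1, fun h ↦ hv'.1 (hsub h)⟩,
        by simpa using hv'.2.2⟩)
  -- A vertex of degree two is no attachment, so its core component meets the cycle. If it met the
  -- cycle only off the segment, the vertex could reach `x₁` while avoiding the segment.
  have inside : ∀ v ∈ S \ D, G.wdeg S x₁ x₂ v = 2 →
      v ∉ G.comp ((S \ D) \ (Finset.Icc i l).image c) x₁ →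
      ∃ s, i < s ∧ s < l ∧ G.Reach (G.core S D x₁) v (c s) := by
    intro v hv hv2 hvn
    by_contra! hs
    have hvx : v ≠ x₁ := fun h ↦ hvn (by rw [h]; exact mem_comp.2 (.refl hx₁))
    have hva : ¬ G.Att D v := by
      intro ha
      obtain ⟨t, h0, ht, rfl⟩ := N.exists_index hv hvx ha
      obtain ⟨d, hd, hadj⟩ := ha
      have := (N.nb_att h0 ht hd hadj).2.2
      omega
    obtain ⟨t, h0, ht, hrt⟩ := N.reach_core hv hvx hva
    have hnot : ∀ k, i ≤ k → k ≤ l → ¬ G.Reach (G.core S D x₁) v (c k) := by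
      intro k h1 h2 h
      have hk := (mem_core.1 h.right_mem).2.2
      by_cases hki : k = i
      · exact hk (hki ▸ hia)
      by_cases hkl : k = l
      · exact hk (hkl ▸ hla)
      exact hs k (by omega) (by omega) h
    have hvt : G.Reach ((S \ D) \ (Finset.Icc i l).image c) v (c t) := by
      refine hrt.in_comp.mono fun w hw ↦ ?_
      refine Finset.mem_sdiff.2 ⟨(mem_core.1 (comp_subset hw)).1, fun h ↦ ?_⟩
      obtain ⟨k, hk, rfl⟩ := Finset.mem_image.1 h
      rw [Finset.mem_Icc] at hk
      exact hnot k hk.1 hk.2 (mem_comp.1 hw)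
    have hout : ∀ k ≤ m, (k < i ∨ l < k) → c k ∈ (S \ D) \ (Finset.Icc i l).image c := by
      intro k hkm hk
      refine Finset.mem_sdiff.2 ⟨N.mem k hkm, fun h ↦ ?_⟩
      obtain ⟨k', hk', hkk⟩ := Finset.mem_image.1 h
      rw [Finset.mem_Icc] at hk'
      have := N.eq_of_eq (by omega) hkm (by omega) (by omega) hkk
      omega
    have hcase : t < i ∨ l < t := by
      by_contra hcon
      exact hnot t (by omega) (by omega) hrt
    refine hvn (mem_comp.2 (Reach.symm (hvt.trans ?_)))
    rcases hcase with h | h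
    · have := Reach.of_seq (G := G) (c := c) (S := (S \ D) \ (Finset.Icc i l).image c)
        (Nat.zero_le t) (fun k _ _ ↦ N.adj k (by omega)) fun k _ _ ↦ hout k (by omega) (by omega)
      rw [N.zero] at this
      exact this.symm
    · have := Reach.of_seq (G := G) (c := c) (S := (S \ D) \ (Finset.Icc i l).image c)
        ht.le (fun k _ _ ↦ N.adj k (by omega)) fun k _ _ ↦ hout k (by omega) (by omega)
      rwa [N.last] at this
  have hyS := (Finset.mem_sdiff.1 hy).1
  have hzS := (Finset.mem_sdiff.1 hz).1
  obtain ⟨s, hs₁, hs₂, hs⟩ := inside y hy ((hex y hyS).2 (.inl rfl)) hkey.1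
  obtain ⟨t, ht₁, ht₂, ht⟩ := inside z hz ((hex z hzS).2 (.inr rfl)) hkey.2
  have g : G.Gap D m c i l := ⟨by omega, hl.le, .inr hia, .inr hla, .inl hi, hbet⟩
  exact ⟨i, l, hi, hl, g, mem_comp.2 ((mem_comp.1 (N.gap_mem g hs₁ hs₂)).trans hs.symm),
    mem_comp.2 ((mem_comp.1 (N.gap_mem g ht₁ ht₂)).trans ht.symm)⟩

end Necklace

end Enclosing

/-! ### Regions with two vertices of degree two -/

section TwoExceptions

variable {V : Type*} [DecidableEq V] {G : SimpleGraph V} [DecidableRel G.Adj]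

theorem AtMostOne.of_notMem {S T : Finset V} {x₁ x₂ y z : V} (hT : T ⊆ S)
    (hex : ∀ v ∈ S, G.wdeg S x₁ x₂ v = 2 ↔ v = y ∨ v = z) (h : y ∉ T ∨ z ∉ T) :
    G.AtMostOne S x₁ x₂ T := by
  intro u hu v hv hu2 hv2
  rw [hex u (hT hu)] at hu2
  rw [hex v (hT hv)] at hv2
  rcases hu2 with rfl | rfl <;> rcases hv2 with rfl | rfl
  · rfl
  · exact absurd h (by tauto)
  · exact absurd h (by tauto)
  · rfl

/-- A region with exactly two vertices `y`, `z` of degree two has two paths between its ends whose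
lengths differ by one or two, or a ladder with more than `k` rungs, where `k` bounds the distance
from the ends to `y`. -/
theorem Region.closeLengths_or_ladder (S : Finset V) : ∀ x₁ x₂ y z k, G.Region S x₁ x₂ →
    y ∈ S → z ∈ S → y ≠ z → (∀ v ∈ S, G.wdeg S x₁ x₂ v = 2 ↔ v = y ∨ v = z) →
    (∀ n, G.HasPath S x₁ y n → k ≤ n) → (∀ n, G.HasPath S x₂ y n → k ≤ n) →
    G.CloseLengths S x₁ x₂ ∨ G.Ladder S x₁ x₂ y z (k + 1) := by
  induction S using Finset.strongInduction with
  | H S IH =>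
  have hleft : ∀ x₁ x₂ y z k, G.Region S x₁ x₂ →
      y ∈ S → z ∈ S → y ≠ z → (∀ v ∈ S, G.wdeg S x₁ x₂ v = 2 ↔ v = y ∨ v = z) →
      (∀ n, G.HasPath S x₁ y n → k ≤ n) → (∀ n, G.HasPath S x₂ y n → k ≤ n) → x₁ ≠ x₂ →
      G.wdeg S x₁ x₂ x₁ = 2 → G.CloseLengths S x₁ x₂ ∨ G.Ladder S x₁ x₂ y z (k + 1) := by
    intro x₁ x₂ y z k hS hy hz hyz hex hk₁ hk₂ hne hw
    obtain ⟨a, ha, hadj, hreg, hwd⟩ := hS.delete_left hne hw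
    rcases closeLengths_or_singleton _ _ _ hreg ((AtMostOne.of_notMem Finset.sdiff_subset hex (by
      rcases (hex x₁ hS.left_mem).1 hw with rfl | rfl <;> simp)).congr hwd) with h | ⟨w, hw'⟩
    · exact .inl (h.cons hadj (by simp) hS.left_mem Finset.sdiff_subset)
    -- Now `S` consists of two adjacent vertices, `y` is one of the ends, and `k = 0`.
    · right
      have hmem : ∀ v ∈ S, v = x₁ ∨ v = x₂ := by
        intro v hv
        by_cases hvx : v = x₁
        · exact .inl hvx
        · have h1 : v ∈ S \ {x₁} := by simp [hv, hvx]
          have h2 : x₂ ∈ S \ {x₁} := hreg.right_mem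
          rw [hw', Finset.mem_singleton] at h1 h2
          exact .inr (h1.trans h2.symm)
      have hax : a = x₂ := (hmem a (Finset.sdiff_subset ha)).resolve_left hadj.ne'
      subst hax
      have hL := Linkage.of_adj hadj hS.left_mem hS.right_mem
      rcases hmem y hy with rfl | rfl
      · have hza := (hmem z hz).resolve_left hyz.symm
        subst hza
        have := hk₁ 0 (.single hy)
        exact .inl (hL.of_le (by omega))
      · have hza := (hmem z hz).resolve_right hyz.symm
        subst hza
        have := hk₂ 0 (.single hy)
        exact .inr (hL.of_le (by omega))
  intro x₁ x₂ y z k hS hy hz hyz hex hk₁ hk₂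
  by_cases hne : x₁ = x₂
  · subst hne
    rw [hS.eq_singleton, Finset.mem_singleton] at hy hz
    exact absurd (hy.trans hz.symm) hyz
  by_cases hw₁ : G.wdeg S x₁ x₂ x₁ = 2
  · exact hleft _ _ _ _ _ hS hy hz hyz hex hk₁ hk₂ hne hw₁
  by_cases hw₂ : G.wdeg S x₁ x₂ x₂ = 2
  · rw [wdeg_comm] at hw₂
    exact (hleft _ _ _ _ _ hS.symm hy hz hyz (fun v hv ↦ by rw [wdeg_comm, hex v hv]) hk₂ hk₁
      (Ne.symm hne) hw₂).imp .reverse .swap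
  have hssub : S \ {x₁, x₂} ⊂ S := Finset.sdiff_ssubset
    (by simp [Finset.insert_subset_iff, hS.left_mem, hS.right_mem]) (by simp)
  have hmid : ∀ v, (v = y ∨ v = z) → v ∈ S \ {x₁, x₂} := by
    intro v hv
    have hvS : v ∈ S := by rcases hv with rfl | rfl <;> assumption
    have := (hex v hvS).2 hv
    refine Finset.mem_sdiff.2 ⟨hvS, ?_⟩
    rw [Finset.mem_insert, Finset.mem_singleton]
    rintro (rfl | rfl)
    · exact hw₁ this
    · exact hw₂ this
  by_cases hadj : G.Adj x₁ x₂
  · obtain ⟨a, ha, b, hb, hxa, hxb, hreg, hwd⟩ := hS.delete_both hadj hw₁ hw₂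
    have hcons : ∀ x a n, x ∈ ({x₁, x₂} : Finset V) → G.Adj x a → G.HasPath (S \ {x₁, x₂}) a y n →
        G.HasPath S x y (n + 1) := by
      intro x a n hx hxa hp
      have := (HasPath.single (G := G) (Finset.mem_singleton_self x)).append (X := S) hp hxa
        (Finset.disjoint_singleton_left.2 fun h ↦ (Finset.mem_sdiff.1 h).2 hx) ?_ hssub.1
      · rwa [Nat.zero_add] at this
      · rw [Finset.singleton_subset_iff]
        rcases Finset.mem_insert.1 hx with rfl | hx
        · exact hS.left_mem
        · rw [Finset.mem_singleton.1 hx]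
          exact hS.right_mem
    -- Deleting the ends costs one unit of distance, and the edge `x₁x₂` returns one rung. For `k =
    -- 0` the truncated subtraction is harmless.
    rcases IH _ hssub a b y z (k - 1) hreg (hmid y (.inl rfl)) (hmid z (.inr rfl)) hyz
      (fun v hv ↦ by rw [hwd v hv, hex v (hssub.1 hv)])
      (fun n hn ↦ by have := hk₁ _ (hcons x₁ a n (by simp) hxa hn); omega)
      (fun n hn ↦ by have := hk₂ _ (hcons x₂ b n (by simp) hxb hn); omega) with h | h
    · exact .inl (h.cons_concat hxa hxb (by simp) (by simp) hne hS.left_mem hS.right_mem hssub.1)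
    · have hL : G.Ladder {x₁, x₂} x₁ x₂ x₁ x₂ 1 := .inl (.of_adj hadj (by simp) (by simp))
      exact .inr ((hL.append h hxa hxb Finset.disjoint_sdiff (by
        simp [Finset.insert_subset_iff, hS.left_mem, hS.right_mem]) hssub.1).of_le (by omega))
  obtain ⟨a, b, hab, hnb⟩ := hS.exists_nb_eq_pair hne hw₁
  by_cases hr : G.Reach (S \ {x₁, x₂}) a b
  · have heq : (S \ {x₂}) \ {x₁} = S \ {x₁, x₂} := by
      ext
      simp only [Finset.mem_sdiff, Finset.mem_singleton, Finset.mem_insert]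
      tauto
    obtain ⟨D, m, c, -, N⟩ := hS.exists_necklace hab hnb (D₀ := {x₂}) (by simpa using hS.right_mem)
      (by simpa using hne) (by simp) (fun v hv ↦ by
        rw [Finset.mem_singleton] at hv
        subst hv
        exact .refl (by simp)) (heq ▸ hr)
    by_cases hD : y ∈ D ∨ z ∈ D
    · exact .inl (N.closeLengths (fun R _ ↦ closeLengths_or_singleton R)
        (.of_notMem Finset.sdiff_subset hex (by simp only [Finset.mem_sdiff]; tauto)))
    rw [not_or] at hD
    rcases N.exists_enclosing_gap hw₂ hw₁ (Finset.mem_sdiff.2 ⟨hy, hD.1⟩)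
      (Finset.mem_sdiff.2 ⟨hz, hD.2⟩) hex with h | ⟨i, l, hi, hl, g, hyR, hzR⟩
    · exact .inl h
    have hgl := g.lt
    have hregR := N.gap_region g
    have hwdR := N.gap_wdeg g
    have hssR := N.gap_ssubset g
    have hregH := N.gap_compl_region g hi hl
    have hpH := Finset.sdiff_subset (N.mem_gap_compl g (t := i) (by omega) (.inl le_rfl))
    have hqH := Finset.sdiff_subset (N.mem_gap_compl g (t := l) hl.le (.inr le_rfl))
    have hwdH : ∀ v ∈ S \ G.comp (G.core S D x₁) (c (i + 1)),
        G.wdeg (S \ G.comp (G.core S D x₁) (c (i + 1))) x₁ x₂ v = 2 ↔ v = c i ∨ v = c l := by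
      intro v hv
      rw [N.gap_compl_wdeg g hi hl hv]
      split_ifs with h
      · simp [h]
      · rw [Finset.mem_sdiff] at hv
        rw [hex v hv.1]
        refine iff_of_false ?_ h
        rintro (rfl | rfl)
        · exact hv.2 hyR
        · exact hv.2 hzR
    have hpr := N.adj i (by omega)
    have hqr := N.adj (l - 1) (by omega)
    rw [Nat.sub_add_cancel (by omega)] at hqr
    have hclose := N.gap_closeLengths g
    have hpq := N.gap_ends_ne g
    generalize hR : G.comp (G.core S D x₁) (c (i + 1)) = R at *
    have hssH : S \ R ⊂ S := Finset.sdiff_ssubset hssR.1 ⟨_, hyR⟩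
    have hjoin : ∀ x p r n e, G.Adj p r → G.HasPath (S \ R) x p n → G.HasPath R r y e →
        G.HasPath S x y (n + e + 1) := fun x p r n e hpr h₁ h₂ ↦
      h₁.append h₂ hpr Finset.sdiff_disjoint hssH.1 hssR.1
    -- `e` is the distance inside `R` from the nearer end to `y`. The attachment next to that end
    -- takes over the role of `y` in the complement.
    obtain ⟨e, he, hmin⟩ : ∃ e, (G.HasPath R (c (i + 1)) y e ∨ G.HasPath R (c (l - 1)) y e) ∧
        ∀ n, (G.HasPath R (c (i + 1)) y n ∨ G.HasPath R (c (l - 1)) y n) → e ≤ n := by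
      classical
      have hne : ∃ e, G.HasPath R (c (i + 1)) y e ∨ G.HasPath R (c (l - 1)) y e := by
        have : G.Reach R (c (i + 1)) y := by
          rw [← hR] at hyR ⊢
          exact (mem_comp.1 hyR).in_comp
        obtain ⟨n, hn⟩ := this.exists_hasPath
        exact ⟨n, .inl hn⟩
      exact ⟨_, Nat.find_spec hne, fun n hn ↦ Nat.find_min' hne hn⟩
    rcases IH R hssR _ _ y z e hregR hyR hzR hyz
      (fun v hv ↦ by rw [hwdR v hv, hex v (hssR.1 hv)]) (fun n hn ↦ hmin n (.inl hn))
      (fun n hn ↦ hmin n (.inr hn)) with h | hLR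
    · exact .inl (hclose h)
    -- Paths to this attachment extend to `y` by `e + 1` edges, so they have length at least `k - 1
    -- - e`. The parts together have `(k - 1 - e + 1) + (e + 1) ≥ k + 1` rungs.
    have hfin : G.CloseLengths (S \ R) x₁ x₂ ∨
        G.Ladder (S \ R) x₁ x₂ (c i) (c l) (k - 1 - e + 1) := by
      rcases he with he | he
      · exact IH _ hssH x₁ x₂ (c i) (c l) (k - 1 - e) hregH hpH hqH hpq hwdH
          (fun n hn ↦ by have := hk₁ _ (hjoin _ _ _ _ _ hpr hn he); omega)
          (fun n hn ↦ by have := hk₂ _ (hjoin _ _ _ _ _ hpr hn he); omega)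
      · exact (IH _ hssH x₁ x₂ (c l) (c i) (k - 1 - e) hregH hqH hpH hpq.symm
          (fun v hv ↦ (hwdH v hv).trans or_comm)
          (fun n hn ↦ by have := hk₁ _ (hjoin _ _ _ _ _ hqr.symm hn he); omega)
          (fun n hn ↦ by have := hk₂ _ (hjoin _ _ _ _ _ hqr.symm hn he); omega)).imp id .comm
    rcases hfin with h | hLH
    · exact .inl (h.mono hssH.1)
    · exact .inr ((hLH.append hLR hpr hqr.symm Finset.sdiff_disjoint hssH.1 hssR.1).of_le
        (by omega))
  · obtain ⟨A, B, a', b', hdis, hun, hxa, hxb, hya, hyb, rA, rB, wA, wB⟩ :=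
      hS.split hne hadj hnb hw₂ hr
    have hA : A ⊆ S \ {x₁, x₂} := hun ▸ Finset.subset_union_left
    have hB : B ⊆ S \ {x₁, x₂} := hun ▸ Finset.subset_union_right
    have hAS := hA.trans hssub.1
    have hBS := hB.trans hssub.1
    have side : ∀ (A : Finset V) (a a' : V), A ⊆ S \ {x₁, x₂} → G.Adj x₁ a → G.Adj x₂ a' →
        G.Region A a a' → (∀ v ∈ A, G.wdeg A a a' v = G.wdeg S x₁ x₂ v) → (y ∉ A ∨ z ∉ A) →
        G.CloseLengths S x₁ x₂ ∨ A = {a} ∧ a = a' ∧ (a = y ∨ a = z) := by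
      intro A a a' hA hxa hya rA wA hyzA
      have hAS := hA.trans hssub.1
      rcases closeLengths_or_singleton _ _ _ rA ((AtMostOne.of_notMem hAS hex hyzA).congr wA)
        with h | ⟨w, rfl⟩
      · exact .inl (h.cons_concat hxa hya (fun h ↦ by simpa using hA h)
          (fun h ↦ by simpa using hA h) hne hS.left_mem hS.right_mem hAS)
      · have h1 := Finset.mem_singleton.1 rA.left_mem
        have h2 := Finset.mem_singleton.1 rA.right_mem
        have h3 := (wA w (by simp)).symm.trans rA.wdeg_singleton
        rw [hex w (hAS (by simp))] at h3
        rw [h1, h2]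
        exact .inr ⟨rfl, rfl, h3⟩
    have hnot : ∀ (A B : Finset V) (a : V), Disjoint A B → A = {a} → (a = y ∨ a = z) →
        y ∉ B ∨ z ∉ B := by
      rintro A B a hd rfl ha
      rw [Finset.disjoint_singleton_left] at hd
      rcases ha with rfl | rfl
      · exact .inl hd
      · exact .inr hd
    -- A side missing `y` or `z` gives close lengths or is a single exceptional vertex. In the
    -- latter case the other side misses that vertex, and the same applies to it.
    have hyzAB : (y ∉ A ∨ z ∉ A) ∨ (y ∉ B ∨ z ∉ B) := by
      by_contra! hcon
      exact Finset.disjoint_left.1 hdis hcon.1.1 hcon.2.1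
    have hcon : G.CloseLengths S x₁ x₂ ∨ (A = {a} ∧ a = a' ∧ (a = y ∨ a = z)) ∧
        B = {b} ∧ b = b' ∧ (b = y ∨ b = z) := by
      rcases hyzAB with h | h
      · rcases side A a a' hA hxa hya rA wA h with h | h
        · exact .inl h
        · exact (side B b b' hB hxb hyb rB wB (hnot A B a hdis h.1 h.2.2)).imp id (⟨h, ·⟩)
      · rcases side B b b' hB hxb hyb rB wB h with h | h
        · exact .inl h
        · exact (side A a a' hA hxa hya rA wA (hnot B A b hdis.symm h.1 h.2.2)).imp id (⟨·, h⟩)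
    rcases hcon with h | ⟨⟨hAa, rfl, ha⟩, hBb, rfl, hb⟩
    · exact .inl h
    -- Only a 4-cycle is left. There `y` is at distance one from `x₁`, so `k ≤ 1` and two rungs
    -- suffice.
    right
    have hsq := Linkage.of_square (S := S) hxa hyb hxb hya hne hab (by
      simp [Finset.insert_subset_iff, hS.left_mem, hS.right_mem, hAS rA.left_mem,
        hBS rB.left_mem])
    have hlen : ∀ w, G.Adj x₁ w → w ∈ S → G.HasPath S x₁ w 1 := by
      intro w hw hwS
      have := (HasPath.single (G := G) (Finset.mem_singleton_self x₁)).append (X := S)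
        (.single (Finset.mem_singleton_self w)) hw (by simpa using hw.ne)
        (by simpa using hS.left_mem) (by simpa using hwS)
      simpa using this
    rcases ha with rfl | rfl
    · have := hk₁ 1 (hlen _ hxa hy)
      have hbz := hb.resolve_left hab.symm
      subst hbz
      exact .inl (hsq.of_le (by omega))
    · have hby := hb.resolve_right hab.symm
      subst hby
      have := hk₁ 1 (hlen _ hxb hy)
      exact .inr (hsq.of_le (by omega))

end TwoExceptions

/-! ### From 2-connected graphs to regions, and back to walks -/

section TwoConnected

variable {V : Type*} [Fintype V] [DecidableEq V] {G : SimpleGraph V} [DecidableRel G.Adj]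

theorem nb_univ_card (v : V) : (G.nb Finset.univ v).card = G.degree v := by
  rw [← card_neighborFinset_eq_degree]
  congr 1
  ext w
  simp

theorem IsTwoConnected.exists_adj (hG : G.IsTwoConnected) {W : Finset V} {v w : V} (hv : v ∈ W)
    (hw : w ∉ W) : ∃ x ∈ W, ∃ y ∉ W, G.Adj x y := by
  obtain ⟨p⟩ := hG.connected.preconnected v w
  have hp : G.Reach Finset.univ v w := ⟨p, fun _ _ ↦ Finset.mem_univ _⟩
  obtain ⟨x, -, y, -, hx, hy, h⟩ := hp.exists_adj hv hw
  exact ⟨x, hx, y, hy, h⟩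

theorem IsTwoConnected.exists_adj_ne (hG : G.IsTwoConnected) {W : Finset V} {u v w : V}
    (hv : v ∈ W) (hvu : v ≠ u) (hw : w ∉ W) (hwu : w ≠ u) :
    ∃ x ∈ W, x ≠ u ∧ ∃ y ∉ W, G.Adj x y := by
  obtain ⟨p⟩ := (hG.connected_delete u).preconnected ⟨v, hvu⟩ ⟨w, hwu⟩
  have hp : G.Reach (Finset.univ \ {u}) v w := by
    refine ⟨p.map (Embedding.induce _).toHom, fun x hx ↦ ?_⟩
    erw [Walk.support_map, List.mem_map] at hx
    obtain ⟨x', -, rfl⟩ := hx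
    exact Finset.mem_sdiff.2 ⟨Finset.mem_univ _, fun h ↦ x'.2 (Finset.mem_singleton.1 h)⟩
  obtain ⟨x, hx', y, -, hx, hy, h⟩ := hp.exists_adj hv hw
  exact ⟨x, hx, by simpa using hx', y, hy, h⟩

/-- If `W` contains both ends, their half-edges suffice. Otherwise `W` has an exit at some vertex
`u`. Either `W = {u}` and the degree of `u` counts, or connectedness after deleting `u` gives an
exit at another vertex. -/
theorem IsTwoConnected.region (hG : G.IsTwoConnected) {x₁ x₂ : V} (hne : x₁ ≠ x₂)
    (hdeg : ∀ v, G.degree v + port x₁ x₂ v ≤ 3) (hdeg' : ∀ v, 2 ≤ G.degree v) :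
    G.Region Finset.univ x₁ x₂ := by
  refine ⟨Finset.mem_univ _, Finset.mem_univ _, fun v _ ↦ ?_, fun W _ hW ↦ ?_⟩
  · rw [wdeg, nb_univ_card]
    exact hdeg v
  have hout : ∀ x ∈ W, ∀ y ∉ W, G.Adj x y →
      1 ≤ (G.nb (Finset.univ \ W) x).card + port x₁ x₂ x := fun x hx y hy h ↦
    (one_le_card_nb (by simpa using hy) h).trans (Nat.le_add_right _ _)
  have e₁ : 1 ≤ (G.nb (Finset.univ \ W) x₁).card + port x₁ x₂ x₁ := by simp [port]; omega
  have e₂ : 1 ≤ (G.nb (Finset.univ \ W) x₂).card + port x₁ x₂ x₂ := by simp [port]; omega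
  have hone : ∀ u w, u ∈ W → w ∉ W →
      1 ≤ (G.nb (Finset.univ \ W) u).card + port x₁ x₂ u →
      2 ≤ ∑ v ∈ W, ((G.nb (Finset.univ \ W) v).card + port x₁ x₂ v) := by
    intro u w hu hw hu1
    by_cases hWu : W = {u}
    · subst hWu
      rw [Finset.sum_singleton]
      refine (hdeg' u).trans (le_trans ?_ (Nat.le_add_right _ _))
      rw [← nb_univ_card]
      refine Finset.card_le_card fun v hv ↦ ?_
      rw [mem_nb] at hv ⊢
      simp [hv.2, hv.2.ne']
    · obtain ⟨v, hv, hvu⟩ := ((Finset.nontrivial_iff_ne_singleton hu).2 hWu).exists_ne u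
      obtain ⟨x, hx, hxu, y, hy, h⟩ := hG.exists_adj_ne hv hvu hw fun h ↦ hw (h ▸ hu)
      exact two_le_cut_of hu hx hu1 (hout x hx y hy h) fun h ↦ absurd h.symm hxu
  by_cases h₁ : x₁ ∈ W
  · by_cases h₂ : x₂ ∈ W
    · exact two_le_cut_of h₁ h₂ e₁ e₂ fun h ↦ absurd h hne
    · exact hone _ _ h₁ h₂ e₁
  · obtain ⟨v, hv⟩ := hW
    obtain ⟨x, hx, y, hy, h⟩ := hG.exists_adj hv h₁
    exact hone x y hx hy (hout x hx y hy h)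

theorem HasPath.exists_walk {S : Finset V} {u v : V} {n : ℕ} (h : G.HasPath S u v n) :
    ∃ p : G.Walk u v, p.IsPath ∧ p.length = n := by
  obtain ⟨A, -, p, hp, hn, -⟩ := h
  exact ⟨p, hp, hn⟩

/-- Disjointness fixes the orientation of each edge, so no edge is counted by two ordered pairs. -/
theorem card_interedges_le_ncard_edgesBetween {A B : Finset V} (hAB : Disjoint A B) :
    (G.interedges A B).card ≤ (G.edgesBetween (A : Set V) (B : Set V)).ncard := by
  rw [← Set.ncard_coe_finset]
  refine Set.ncard_le_ncard_of_injOn (fun e ↦ s(e.1, e.2)) ?_ ?_ (Set.toFinite _)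
  · rintro ⟨u, v⟩ h
    rw [Finset.mem_coe, mem_interedges_iff] at h
    exact ⟨h.2.2, ⟨u, h.1, by simp⟩, v, h.2.1, by simp⟩
  · rintro ⟨u, v⟩ h ⟨u', v'⟩ h' heq
    rw [Finset.mem_coe, mem_interedges_iff] at h h'
    simp only [Sym2.eq_iff] at heq
    rcases heq with ⟨rfl, rfl⟩ | ⟨rfl, rfl⟩
    · rfl
    · exact absurd h'.2.1 (Finset.disjoint_left.1 hAB h.1)

theorem Linkage.exists_walks {S : Finset V} {x₁ x₂ y z : V} {n : ℕ}
    (h : G.Linkage S x₁ x₂ y z n) :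
    ∃ (Q₁ : G.Walk x₁ y) (Q₂ : G.Walk x₂ z),
      Q₁.IsPathBetween {x₁, x₂} {y, z} ∧ Q₂.IsPathBetween {x₁, x₂} {y, z} ∧
      Disjoint {v | v ∈ Q₁.support} {v | v ∈ Q₂.support} ∧
      n ≤ (G.edgesBetween {v | v ∈ Q₁.support} {v | v ∈ Q₂.support}).ncard := by
  obtain ⟨A, B, -, -, hAB, ⟨k, p, hp, -, rfl⟩, ⟨l, q, hq, -, rfl⟩, hn⟩ := h
  have hd : ∀ w ∈ p.support, w ∉ q.support := fun w h₁ h₂ ↦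
    Finset.disjoint_left.1 hAB (List.mem_toFinset.2 h₁) (List.mem_toFinset.2 h₂)
  have hset : ∀ {u v : V} (p : G.Walk u v),
      ((p.support.toFinset : Finset V) : Set V) = {w | w ∈ p.support} := fun p ↦ by
    ext
    simp
  refine ⟨p, q, ⟨hp, by simp, by simp, fun w hw h1 h2 ↦ ?_⟩,
    ⟨hq, by simp, by simp, fun w hw h1 h2 ↦ ?_⟩, Set.disjoint_left.2 hd, ?_⟩
  · have h3 : w ≠ x₂ := fun h ↦ hd w hw (h ▸ q.start_mem_support)
    have h4 : w ≠ z := fun h ↦ hd w hw (h ▸ q.end_mem_support)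
    simp [h1, h2, h3, h4]
  · have h3 : w ≠ x₁ := fun h ↦ hd w (h ▸ p.start_mem_support) hw
    have h4 : w ≠ y := fun h ↦ hd w (h ▸ p.end_mem_support) hw
    simp [h1, h2, h3, h4]
  · have := hn.trans (card_interedges_le_ncard_edgesBetween hAB)
    rwa [hset, hset] at this

end TwoConnected

end SimpleGraph

theorem mainTheorem9 {V : Type*} [Fintype V] (G : SimpleGraph V) [DecidableRel G.Adj]
    (k : ℕ) (hG : G.IsTwoConnected) (x₁ x₂ y z : V)
    (hdistinct : [x₁, x₂, y, z].Nodup)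
    (hx₁ : G.degree x₁ = 2) (hx₂ : G.degree x₂ = 2) (hy : G.degree y = 2) (hz : G.degree z = 2)
    (hdeg : ∀ v : V, v ≠ x₁ → v ≠ x₂ → v ≠ y → v ≠ z → G.degree v = 3)
    (hdist₁ : k ≤ G.dist x₁ y) (hdist₂ : k ≤ G.dist x₂ y) :
    (∃ P₁ P₂ : G.Walk x₁ x₂, P₁.IsPath ∧ P₂.IsPath ∧
      (P₁.length = P₂.length + 1 ∨ P₁.length = P₂.length + 2)) ∨
    (∃ (a b c d : V) (Q₁ : G.Walk a b) (Q₂ : G.Walk c d),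
      Q₁.IsPathBetween {x₁, x₂} {y, z} ∧ Q₂.IsPathBetween {x₁, x₂} {y, z} ∧
      Disjoint {v | v ∈ Q₁.support} {v | v ∈ Q₂.support} ∧
      k ≤ (G.edgesBetween {v | v ∈ Q₁.support} {v | v ∈ Q₂.support}).ncard) := by
  classical
  simp only [List.nodup_cons, List.mem_cons, List.not_mem_nil, or_false, not_or] at hdistinct
  obtain ⟨⟨h12, h1y, h1z⟩, ⟨h2y, h2z⟩, hyz, -⟩ := hdistinct
  -- The half-edges raise `x₁` and `x₂` to degree three, leaving only `y` and `z` exceptional.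
  have hw : ∀ v, G.degree v + SimpleGraph.port x₁ x₂ v = if v = y ∨ v = z then 2 else 3 := by
    intro v
    by_cases e1 : v = x₁
    · subst e1
      simp [SimpleGraph.port, hx₁, h12, h1y, h1z]
    by_cases e2 : v = x₂
    · subst e2
      simp [SimpleGraph.port, hx₂, e1, h2y, h2z]
    by_cases e3 : v = y
    · subst e3
      simp [SimpleGraph.port, hy, e1, e2]
    by_cases e4 : v = z
    · subst e4
      simp [SimpleGraph.port, hz, e1, e2]
    simp [SimpleGraph.port, e1, e2, e3, e4, hdeg v e1 e2 e3 e4]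
  have hdeg' : ∀ v, 2 ≤ G.degree v := by
    intro v
    by_cases e : v = x₁ ∨ v = x₂ ∨ v = y ∨ v = z
    · rcases e with rfl | rfl | rfl | rfl <;> omega
    · simp only [not_or] at e
      have := hdeg v e.1 e.2.1 e.2.2.1 e.2.2.2
      omega
  have hreg := hG.region h12 (fun v ↦ by rw [hw v]; split_ifs <;> omega) hdeg'
  have hdist : ∀ x, k ≤ G.dist x y → ∀ n, G.HasPath Finset.univ x y n → k ≤ n := by
    intro x hx n hn
    obtain ⟨p, -, rfl⟩ := hn.exists_walk
    exact hx.trans (SimpleGraph.dist_le p)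
  rcases SimpleGraph.Region.closeLengths_or_ladder Finset.univ x₁ x₂ y z k hreg (Finset.mem_univ _)
    (Finset.mem_univ _) hyz (fun v _ ↦ by
      rw [SimpleGraph.wdeg, SimpleGraph.nb_univ_card, hw v]
      split_ifs with h <;> simp [h]) (hdist x₁ hdist₁) (hdist x₂ hdist₂) with h | h | h
  · obtain ⟨n, n', h₁, h₂, hnn⟩ := h
    obtain ⟨p₁, hp₁, rfl⟩ := h₁.exists_walk
    obtain ⟨p₂, hp₂, rfl⟩ := h₂.exists_walk
    exact .inl ⟨p₂, p₁, hp₂, hp₁, hnn⟩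
  -- The induction yields `k + 1` rungs, one more than needed.
  · obtain ⟨Q₁, Q₂, h₁, h₂, hd, hn⟩ := (h.of_le (Nat.le_succ k)).exists_walks
    exact .inr ⟨_, _, _, _, Q₁, Q₂, h₁, h₂, hd, hn⟩
  · obtain ⟨Q₁, Q₂, h₁, h₂, hd, hn⟩ := (h.of_le (Nat.le_succ k)).exists_walks
    rw [Set.pair_comm z y] at h₁ h₂
    exact .inr ⟨_, _, _, _, Q₁, Q₂, h₁, h₂, hd, hn⟩
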